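/- There is a numerical constant $C>0$ such that the following holds. Let $d\ge 3$, $n,m\ge 1$ be integers and let $0<\sigma<1$ satisfy \[ n\ge C d^6,\qquad \sigma\le \frac{1}{C\, n^{1/2}\,(\ln d)^{1/2}\,\ln(dnm/\sigma)} . \] For every two-element set $I\subseteq\{1,\dots,d\}$ let $\eta_{I,\sigma}$ be the Gaussian distribution on $\mathbb{R}^d$ with mean zero and covariance matrix $\Sigma_{I,\sigma}$, where $\Sigma_{I,\sigma}(i,i)=1$ for all $i$, $\Sigma_{I,\sigma}(i,j)=\sigma$ if $I=\{i,j\}$, and all other entries are $0$. Consider any randomized $m$-party protocol in which each party holds $n$ samples in $\mathbb{R}^d$ and the parties communicate by broadcasting bits: who speaks next is determined by the bits broadcast so far and the (public or private) randomness, the bit that is sent may depend also on the speaker's own samples, and when the protocol halts its output is determined by the bits broadcast and the randomness. Suppose that for every $I$, if all $mn$ samples are drawn independently from $\eta_{I,\sigma}$ (and independently of the randomness), then the protocol outputs $I$ with probability at least $1-\frac16$. Then the communication complexity of the protocol, that is, the maximal number of bits sent over all inputs and all values of the randomness, is at least \[ \frac{d^2}{C\,\sigma^2\,\ln^2(nmd/\sigma)\,\ln\!\big(d/(n\sigma^2)\big)\,n}.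 \] -/

import Mathlib

open MeasureTheory ProbabilityTheory
open scoped ENNReal

universe u

/-- A deterministic `m`-party communication protocol in the broadcast (blackboard) model, as a
finite binary protocol tree. Each party holds an input in `X`. At an inner node, determined by the
bits broadcast so far, party `speaker` broadcasts one bit, a measurable function of her own input;
a longer message is a run of nodes with the same speaker. At a leaf the protocol halts with an
output that is determined by the transcript. -/
inductive DetProtocol (m : ℕ) (X : Type*) (O : Type*) [MeasurableSpace X] where
  | halt (out : O) : DetProtocol m X O
  | send (speaker : Fin m) (bit : X → Bool) (bit_measurable : Measurable bit)
      (next : Bool → DetProtocol m X O) : DetProtocol m X O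

namespace DetProtocol

variable {m : ℕ} {X O : Type*} [MeasurableSpace X]

/-- The output of a deterministic protocol on the inputs `x 0, …, x (m - 1)` of the parties. -/
def output : DetProtocol m X O → (Fin m → X) → O
  | halt out, _ => out
  | send j bit _ next, x => (next (bit (x j))).output x

/-- The number of bits sent by a deterministic protocol on the given inputs. -/
def bitsSent : DetProtocol m X O → (Fin m → X) → ℕ
  | halt _, _ => 0
  | send j bit _ next, x => (next (bit (x j))).bitsSent x + 1

end DetProtocol

/-- A randomized `m`-party protocol: once the random coins are fixed, it is a deterministic
protocol. The coins are allowed to be public; private randomness is the special case in which the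
coins are a tuple of independent coordinates, one for each party, and the bits that a party sends
depend only on her own coordinate. -/
structure RandProtocol (m : ℕ) (X : Type*) (O : Type*) [MeasurableSpace X] where
  /-- The sample space of the coins. -/
  Coins : Type u
  [coinsMeasurableSpace : MeasurableSpace Coins]
  /-- The law of the coins. -/
  law : Measure Coins
  [law_isProbabilityMeasure : IsProbabilityMeasure law]
  /-- The deterministic protocol that is run, given the coins. -/
  det : Coins → DetProtocol m X O
  /-- The events whose probabilities define the error are measurable. -/
  measurableSet_output : ∀ o : O,
    MeasurableSet {p : Coins × (Fin m → X) | (det p.1).output p.2 = o}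

attribute [instance] RandProtocol.coinsMeasurableSpace RandProtocol.law_isProbabilityMeasure

namespace RandProtocol

variable {m : ℕ} {X O : Type*} [MeasurableSpace X]

/-- The communication complexity: the maximal number of bits sent, over all inputs and all values
of the randomness (`⊤` if there is no bound). -/
noncomputable def commComplexity (π : RandProtocol.{u} m X O) : ℕ∞ :=
  ⨆ (c : π.Coins) (x : Fin m → X), ((π.det c).bitsSent x : ℕ∞)

/-- `π` is an `(m, n)`-protocol that identifies the family `μ` with error `ε`: each of the `m`
parties receives `n` samples, all `m * n` samples are independent with the same law `μ i`, they are
independent of the coins, and for every `i` the output is `i` with probability at least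
`1 - ε`. -/
def Identifies {n : ℕ} {S ι : Type*} [MeasurableSpace S]
    (π : RandProtocol.{u} m (Fin n → S) ι) (μ : ι → Measure S) (ε : ℝ) : Prop :=
  ∀ i : ι, 1 - ε ≤
    (π.law.prod (Measure.pi fun _ : Fin m => Measure.pi fun _ : Fin n => μ i)).real
      {p | (π.det p.1).output p.2 = i}

end RandProtocol

/-- The two-element subsets of the set of coordinates. -/
abbrev CoordPair (d : ℕ) : Type := {I : Finset (Fin d) // I.card = 2}

/-- The covariance matrix with unit variances and correlation `σ` at the pair `I` only. -/
def pairCov {d : ℕ} (σ : ℝ) (I : CoordPair d) : Matrix (Fin d) (Fin d) ℝ :=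
  Matrix.of fun i j => if i = j then 1 else if I.1 = {i, j} then σ else 0

/-- The centered Gaussian distribution on `ℝ^d` with covariance matrix `pairCov σ I`. -/
noncomputable def pairGaussian {d : ℕ} (σ : ℝ) (I : CoordPair d) :
    Measure (EuclideanSpace ℝ (Fin d)) :=
  multivariateGaussian 0 (pairCov σ I)

/-! Let `L I` be the density of `pairGaussian σ I` relative to the standard Gaussian, and let `N` be
the number of pairs, of order `d ^ 2`. Of two distinct pairs one contains a coordinate that the
other lacks, and integrating it out turns the density of the first into `1`. Hence the functions `L
I - 1` are orthogonal, with norms `O(σ)` (`CoordPair.isBesselFamily_density`). So an event about one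
party's samples cannot be correlated with many pairs at once. If it consists of typical samples and
has null probability `p`, then the squared deviations of its likelihood ratios from `1`, summed over
all pairs, are at most `K * -log p` with `K = O(σ ^ 2 n log ^ 2 Z)` and `Z = n m d / σ`
(`IsBesselFamily.sum_likelihood_sub_one_sq_le_mul_neg_log`).

A transcript is a product of events, one for each party, so the informations `-log p` of these
events add up to that of the transcript. Their mean is the entropy of the transcript, at most `B +
1` when `B` bits are sent. Therefore the squared Hellinger distances between the transcript laws
under the single pairs and under the null law have sum `O(K (B + 1))`, up to atypical samples. A
correct protocol outputs `I` much more often under `I` than under the null law, for the average `I`,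
which makes this sum at least of order `N`. Thus `B` is at least of order `d ^ 2 / K`
(`card_le_of_separates`).

The bound for events is proved for functions `f` with values in `[0, 1]`, with entropy in place of
`-log p`. For one sample it is a duality between entropy and `L²` combined with Bessel's inequality;
for `n` samples the chain rule of entropy adds up the one-sample bounds. Where `f` far exceeds its
mean, the duality needs a uniform bound `M` on `|L I - 1|`; therefore the samples are restricted to
`likelihoodBall`, whose complement has mass polynomially small in `Z`. The uniform bound costs a
term `N ^ 2 M ^ 2`, which is absorbed because `d ^ 4 ≤ n`. -/

/-! ### Transcripts as rectangles, and their entropy -/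

/-- The transcripts of a deterministic protocol: a finite partition of the inputs into measurable
rectangles on which output and length are constant, the lengths satisfying Kraft's inequality. -/
theorem DetProtocol.exists_leaves {m : ℕ} {X O : Type*} [MeasurableSpace X]
    (π : DetProtocol m X O) :
    ∃ (T : Type) (_ : Fintype T) (R : T → Fin m → Set X) (out : T → O) (len : T → ℕ),
      (∀ t j, MeasurableSet (R t j)) ∧ (∀ x : Fin m → X, ∃! t, ∀ j, x j ∈ R t j) ∧
      (∀ x t, (∀ j, x j ∈ R t j) → π.output x = out t ∧ π.bitsSent x = len t) ∧
      ∑ t, (1 / 2 : ℝ) ^ len t ≤ 1 := by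
  classical
  induction π with
  | halt o =>
    exact ⟨Unit, inferInstance, fun _ _ => Set.univ, fun _ => o, fun _ => 0,
      fun _ _ => MeasurableSet.univ, fun x => ⟨(), by simp, fun _ _ => rfl⟩,
      fun x t _ => ⟨rfl, rfl⟩, by simp⟩
  | send j bit hbit next ih =>
    choose T hT R out len hR hpart hval hkraft using ih
    -- Sending a bit cuts each rectangle of a subtree along the speaker's side only.
    have key : ∀ (x : Fin m → X) (β) (t : T β),
        (∀ i, x i ∈ if i = j then R β t i ∩ bit ⁻¹' {β} else R β t i) ↔
          bit (x j) = β ∧ ∀ i, x i ∈ R β t i := by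
      intro x β t
      constructor
      · intro h
        refine ⟨by have := h j; simp at this; exact this.2, fun i => ?_⟩
        have := h i
        split_ifs at this
        · exact this.1
        · exact this
      · rintro ⟨h1, h2⟩ i
        split_ifs with hi
        · exact ⟨h2 i, by simp [hi, h1]⟩
        · exact h2 i
    refine ⟨Σ β, T β, inferInstance,
      fun t i => if i = j then R t.1 t.2 i ∩ bit ⁻¹' {t.1} else R t.1 t.2 i,
      fun t => out t.1 t.2, fun t => len t.1 t.2 + 1, ?_, ?_, ?_, ?_⟩
    · intro t i
      dsimp only
      split_ifs
      · exact (hR _ _ _).inter (hbit (measurableSet_singleton _))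
      · exact hR _ _ _
    · intro x
      obtain ⟨t, ht, htu⟩ := hpart (bit (x j)) x
      refine ⟨⟨bit (x j), t⟩, (key x _ _).2 ⟨rfl, ht⟩, ?_⟩
      rintro ⟨β, t'⟩ h
      obtain ⟨h1, h2⟩ := (key x _ _).1 h
      subst h1
      rw [htu t' h2]
    · rintro x ⟨β, t⟩ h
      obtain ⟨h1, h2⟩ := (key x _ _).1 h
      subst h1
      obtain ⟨h3, h4⟩ := hval _ x t h2
      exact ⟨h3, by simp [DetProtocol.bitsSent, h4]⟩
    · rw [Fintype.sum_sigma]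
      simp only [pow_succ, ← Finset.sum_mul, Fintype.sum_bool]
      linarith [hkraft true, hkraft false]

/-- The law of product inputs, evaluated on a union of rectangles of a partition. -/
theorem pi_real_setOf_exists_rectangle {m : ℕ} {X T : Type*} [MeasurableSpace X] [Fintype T]
    {R : T → Fin m → Set X} (hR : ∀ t j, MeasurableSet (R t j))
    (hpart : ∀ x : Fin m → X, ∃! t, ∀ j, x j ∈ R t j)
    (ρ : Fin m → Measure X) [∀ j, IsFiniteMeasure (ρ j)] (S : Finset T) :
    (Measure.pi ρ).real {x | ∃ t ∈ S, ∀ j, x j ∈ R t j} = ∑ t ∈ S, ∏ j, (ρ j).real (R t j) := by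
  have h1 : {x : Fin m → X | ∃ t ∈ S, ∀ j, x j ∈ R t j} =
      ⋃ t ∈ S, Set.univ.pi (R t) := by
    ext x; simp [Set.mem_pi]
  rw [h1, measureReal_biUnion_finset]
  · refine Finset.sum_congr rfl fun t _ => ?_
    simp [Measure.real, Measure.pi_pi, ENNReal.toReal_prod]
  · intro t _ t' _ htt'
    refine Set.disjoint_left.2 fun x hx hx' => htt' ?_
    exact (hpart x).unique (by simpa [Set.mem_pi] using hx) (by simpa [Set.mem_pi] using hx')
  · exact fun t _ => MeasurableSet.univ_pi (hR t)

theorem sum_prod_real_rectangle {m : ℕ} {X T : Type*} [MeasurableSpace X] [Fintype T]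
    {R : T → Fin m → Set X} (hR : ∀ t j, MeasurableSet (R t j))
    (hpart : ∀ x : Fin m → X, ∃! t, ∀ j, x j ∈ R t j)
    (ρ : Fin m → Measure X) [∀ j, IsFiniteMeasure (ρ j)] :
    ∑ t, ∏ j, (ρ j).real (R t j) = ∏ j, (ρ j).real Set.univ := by
  rw [← pi_real_setOf_exists_rectangle hR hpart ρ Finset.univ]
  have : {x : Fin m → X | ∃ t ∈ Finset.univ, ∀ j, x j ∈ R t j} = Set.univ := by
    ext x
    simpa using (hpart x).exists
  rw [this]
  simp only [Measure.real, Measure.pi_univ, ENNReal.toReal_prod]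

/-- Source coding: a subprobability on codewords of length at most `B` has entropy at most
`B + 1`. -/
theorem sum_negMulLog_le_of_kraft {T : Type*} [Fintype T] (p : T → ℝ) (len : T → ℕ) (B : ℕ)
    (hp : ∀ t, 0 ≤ p t) (hsum : ∑ t, p t ≤ 1) (hlen : ∀ t, 0 < p t → len t ≤ B)
    (hkraft : ∑ t, (1 / 2 : ℝ) ^ len t ≤ 1) :
    ∑ t, Real.negMulLog (p t) ≤ B + 1 := by
  -- Gibbs' inequality for each codeword against the weight `2 ^ (-len t)`. Entropy is in nats, so
  -- `log 2 < 1` removes the factor of `len t`. The differences of weights sum to at most `1`, which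
  -- is the `+ 1` in the claim.
  have h : ∀ t, Real.negMulLog (p t) ≤ p t * B + ((1 / 2 : ℝ) ^ len t - p t) := by
    intro t
    rcases (hp t).eq_or_lt with h0 | h0
    · rw [← h0]; simp
    · have hw : (0 : ℝ) < (1 / 2 : ℝ) ^ len t := by positivity
      have h1 := Real.log_le_sub_one_of_pos (div_pos hw h0)
      rw [Real.log_div hw.ne' h0.ne', Real.log_pow, one_div, Real.log_inv] at h1
      have h2 : p t * (len t * -Real.log 2 - Real.log (p t)) ≤
          p t * ((2⁻¹ : ℝ) ^ len t / p t - 1) := mul_le_mul_of_nonneg_left h1 h0.le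
      have h3 : p t * ((2⁻¹ : ℝ) ^ len t / p t - 1) = (2⁻¹ : ℝ) ^ len t - p t := by
        field_simp
      have h4 : (len t : ℝ) ≤ B := by exact_mod_cast hlen t h0
      have h5 : (len t : ℝ) * Real.log 2 ≤ B := by
        have := Real.log_two_lt_d9
        nlinarith [Real.log_two_gt_d9, (Nat.cast_nonneg (len t) : (0 : ℝ) ≤ len t)]
      have h6 := mul_le_mul_of_nonneg_left h5 h0.le
      rw [Real.negMulLog, one_div]
      linarith
  calc ∑ t, Real.negMulLog (p t) ≤ ∑ t, (p t * B + ((1 / 2 : ℝ) ^ len t - p t)) :=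
        Finset.sum_le_sum fun t _ => h t
    _ = (∑ t, p t) * B + (∑ t, (1 / 2 : ℝ) ^ len t - ∑ t, p t) := by
        rw [Finset.sum_add_distrib, Finset.sum_sub_distrib, Finset.sum_mul]
    _ ≤ B + 1 := by
        have := mul_le_mul_of_nonneg_right hsum (Nat.cast_nonneg B : (0 : ℝ) ≤ B)
        have := Finset.sum_nonneg fun t (_ : t ∈ Finset.univ) => hp t
        linarith

/-! ### Hellinger distance and the abstract communication bound -/

/-- The linear term is kept exactly: in the application it nearly cancels on summation over the
leaves, leaving the quadratic one. -/
theorem neg_log_le_one_sub_add_two_mul_sq {u : ℝ} (hu : |u - 1| ≤ 1 / 2) :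
    -Real.log u ≤ 1 - u + 2 * (u - 1) ^ 2 := by
  obtain ⟨h1, h2⟩ := abs_le.1 hu
  have h0 : 0 < u := by linarith
  have h := Real.one_sub_inv_le_log_of_pos (x := √u) (by positivity)
  have hs : Real.log (√u) = Real.log u / 2 := Real.log_sqrt h0.le
  set s := √u with hsdef
  have hsq : s ^ 2 = u := Real.sq_sqrt h0.le
  have hs0 : 0 < s := by positivity
  have hs1 : 7 / 10 ≤ s := by
    apply Real.le_sqrt_of_sq_le; norm_num; linarith
  have h3 : -Real.log u ≤ 2 * (s⁻¹ - 1) := by rw [hs] at h; linarith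
  refine h3.trans ?_
  have h4 : s⁻¹ - 1 = (1 - s) / s := by field_simp
  rw [h4, ← hsq, ← mul_div_assoc, div_le_iff₀ hs0]
  have h5 : 0 ≤ 2 * s * (1 + s) ^ 2 - s - 2 := by nlinarith
  nlinarith [mul_nonneg (sq_nonneg (1 - s)) h5]

/-- From `2 * (1 - √x) ≤ -log x`, the product over the parties becomes a sum. -/
theorem two_mul_one_sub_sqrt_prod_le {ι : Type*} (S : Finset ι) {u : ι → ℝ}
    (hu : ∀ i, |u i - 1| ≤ 1 / 2) :
    2 * (1 - √(∏ i ∈ S, u i)) ≤ ∑ i ∈ S, (1 - u i + 2 * (u i - 1) ^ 2) := by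
  have hpos : ∀ i, 0 < u i := fun i => by linarith [(abs_le.1 (hu i)).1]
  have h0 : 0 < ∏ i ∈ S, u i := Finset.prod_pos fun i _ => hpos i
  have h1 := Real.log_le_sub_one_of_pos (Real.sqrt_pos.2 h0)
  rw [Real.log_sqrt h0.le, Real.log_prod (fun i _ => (hpos i).ne')] at h1
  have h2 := Finset.sum_le_sum fun i (_ : i ∈ S) => neg_log_le_one_sub_add_two_mul_sq (hu i)
  rw [Finset.sum_neg_distrib] at h2
  linarith

/-- Write `q - p = (√q - √p) * (√q + √p)` and apply `a * b ≤ 8 * a ^ 2 + b ^ 2 / 32` and `(√q + √p)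
^ 2 ≤ 2 * (p + q)`. The small weight of `p + q` costs only `1 / 8` for a pair of subprobabilities.
-/
theorem sub_le_hellinger {p q : ℝ} (hp : 0 ≤ p) (hq : 0 ≤ q) :
    q - p ≤ 8 * (p + q - 2 * √(p * q)) + (p + q) / 16 := by
  rw [Real.sqrt_mul hp]
  nlinarith [Real.sq_sqrt hp, Real.sq_sqrt hq, sq_nonneg (15 * (√q - √p) - (√q + √p) ),
    sq_nonneg (√q - √p), sq_nonneg (16 * (√q - √p) - (√q + √p) )]

open Classical in
/-- A protocol whose output separates the `ν i` from `ν₀` must be long, if the likelihood ratios of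
all events inside a set `G` of almost full measure are controlled by the information `-log` of the
event. -/
theorem card_le_of_separates {m : ℕ} {X ι : Type*} [MeasurableSpace X] [Fintype ι]
    (π : DetProtocol m X ι) (B : ℕ) (hB : ∀ x, π.bitsSent x ≤ B)
    (ν₀ : Measure X) [IsProbabilityMeasure ν₀] (ν : ι → Measure X)
    [∀ i, IsProbabilityMeasure (ν i)] (hac : ∀ i, ν i ≪ ν₀) {G : Set X} (hG : MeasurableSet G)
    {δ K : ℝ} (hδ0 : 0 ≤ δ) (hδ1 : δ ≤ 1) (hK : 0 ≤ K) (hG0 : 1 - δ ≤ ν₀.real G)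
    (hGi : ∀ i, 1 - δ ≤ (ν i).real G)
    (hA : ∀ A, MeasurableSet A → A ⊆ G → 0 < ν₀.real A →
      (∀ i, |(ν i).real A / ν₀.real A - 1| ≤ 1 / 2) ∧
      ∑ i, ((ν i).real A / ν₀.real A - 1) ^ 2 ≤ K * -Real.log (ν₀.real A))
    (hsep : (Fintype.card ι : ℝ) / 2 ≤ ∑ i,
      ((Measure.pi fun _ => ν i).real {x | π.output x = i} -
        (Measure.pi fun _ => ν₀).real {x | π.output x = i})) :
    3 / 8 * (Fintype.card ι : ℝ) ≤ 17 * Fintype.card ι * (m * δ) + 16 * K * (B + 1) := by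
  obtain ⟨T, _, R, out, len, hR, hpart, hval, hkraft⟩ := π.exists_leaves
  have hrect : ∀ i, {x | π.output x = i} =
      {x | ∃ t ∈ Finset.univ.filter (fun t => out t = i), ∀ j, x j ∈ R t j} := by
    intro i
    ext x
    simp only [Set.mem_ofPred_eq, Finset.mem_filter, Finset.mem_univ, true_and]
    constructor
    · intro h
      obtain ⟨t, ht, -⟩ := hpart x
      exact ⟨t, by rw [← (hval x t ht).1, h], ht⟩
    · rintro ⟨t, h, ht⟩
      rw [(hval x t ht).1, h]
  have hmR : ∀ t j, MeasurableSet (R t j ∩ G) := fun t j => (hR t j).inter hG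
  -- the leaf masses inside `G`
  set p : T → ℝ := fun t => ∏ j, ν₀.real (R t j ∩ G) with hp
  set q : ι → T → ℝ := fun i t => ∏ j, (ν i).real (R t j ∩ G) with hq
  have hp0 : ∀ t, 0 ≤ p t := fun t => Finset.prod_nonneg fun _ _ => measureReal_nonneg
  have hq0 : ∀ i t, 0 ≤ q i t := fun i t => Finset.prod_nonneg fun _ _ => measureReal_nonneg
  have htot : ∀ ρ : Fin m → Measure X, (∀ j, IsProbabilityMeasure (ρ j)) →
      ∑ t, ∏ j, (ρ j).real (R t j ∩ G) = ∏ j, (ρ j).real G := by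
    intro ρ hρ
    have := sum_prod_real_rectangle hR hpart (fun j => (ρ j).restrict G)
    simpa [measureReal_restrict_apply, hR] using this
  have hP : ∑ t, p t = ν₀.real G ^ m := by simpa using htot (fun _ => ν₀) (fun _ => inferInstance)
  have hQ : ∀ i, ∑ t, q i t = (ν i).real G ^ m := fun i => by
    simpa using htot (fun _ => ν i) (fun _ => inferInstance)
  have hbern : ∀ x : ℝ, 1 - δ ≤ x → 1 - m * δ ≤ x ^ m := by
    intro x hx
    have h1 := one_add_mul_le_pow (a := -δ) (by linarith) m
    have h2 : (1 + -δ) ^ m ≤ x ^ m := pow_le_pow_left₀ (by linarith) (by linarith) m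
    linarith
  have hP1 : 1 - m * δ ≤ ∑ t, p t := hP ▸ hbern _ hG0
  have hP2 : ∑ t, p t ≤ 1 := hP ▸ pow_le_one₀ measureReal_nonneg measureReal_le_one
  have hQ1 : ∀ i, 1 - m * δ ≤ ∑ t, q i t := fun i => hQ i ▸ hbern _ (hGi i)
  have hQ2 : ∀ i, ∑ t, q i t ≤ 1 := fun i =>
    hQ i ▸ pow_le_one₀ measureReal_nonneg measureReal_le_one
  obtain ⟨H, hH⟩ : ∃ H : ι → T → ℝ, ∀ i t, H i t = p t + q i t - 2 * √(p t * q i t) :=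
    ⟨_, fun _ _ => rfl⟩
  have hH0 : ∀ i t, 0 ≤ H i t := by
    intro i t
    rw [hH, Real.sqrt_mul (hp0 t)]
    nlinarith [Real.sq_sqrt (hp0 t), Real.sq_sqrt (hq0 i t), sq_nonneg (√(p t) - √(q i t))]
  -- separation forces a large Hellinger distance
  have hlow : ∀ i, (Measure.pi fun _ => ν i).real {x | π.output x = i} -
      (Measure.pi fun _ => ν₀).real {x | π.output x = i} ≤
      m * δ + 1 / 8 + 8 * ∑ t, H i t := by
    intro i
    set S := Finset.univ.filter (fun t => out t = i) with hS
    have e1 : (Measure.pi fun _ => ν i).real {x | π.output x = i} =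
        ∑ t ∈ S, ∏ j, (ν i).real (R t j) := by
      rw [hrect]; exact pi_real_setOf_exists_rectangle hR hpart (fun _ => ν i) S
    have e2 : (Measure.pi fun _ => ν₀).real {x | π.output x = i} =
        ∑ t ∈ S, ∏ j, ν₀.real (R t j) := by
      rw [hrect]; exact pi_real_setOf_exists_rectangle hR hpart (fun _ => ν₀) S
    have e3 : ∑ t, ∏ j, (ν i).real (R t j) = 1 := by
      simpa using sum_prod_real_rectangle hR hpart (fun _ => ν i)
    have e4 : ∀ t, q i t ≤ ∏ j, (ν i).real (R t j) := fun t =>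
      Finset.prod_le_prod (fun _ _ => measureReal_nonneg)
        (fun j _ => measureReal_mono Set.inter_subset_left)
    have e5 : ∀ t, p t ≤ ∏ j, ν₀.real (R t j) := fun t =>
      Finset.prod_le_prod (fun _ _ => measureReal_nonneg)
        (fun j _ => measureReal_mono Set.inter_subset_left)
    -- The mass outside `G` lost on `S` is at most the total loss, hence at most `m * δ`.
    have e6 : ∑ t ∈ S, (∏ j, (ν i).real (R t j) - q i t) ≤
        ∑ t, (∏ j, (ν i).real (R t j) - q i t) :=
      Finset.sum_le_sum_of_subset_of_nonneg (Finset.subset_univ _)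
        (fun t _ _ => sub_nonneg.2 (e4 t))
    rw [Finset.sum_sub_distrib, Finset.sum_sub_distrib, e3] at e6
    have e7 : ∑ t ∈ S, p t ≤ ∑ t ∈ S, ∏ j, ν₀.real (R t j) := Finset.sum_le_sum fun t _ => e5 t
    have e8 : ∑ t ∈ S, (q i t - p t) ≤ ∑ t ∈ S, (8 * H i t + (p t + q i t) / 16) :=
      Finset.sum_le_sum fun t _ => hH i t ▸ sub_le_hellinger (hp0 t) (hq0 i t)
    have e9 : ∑ t ∈ S, (8 * H i t + (p t + q i t) / 16) ≤
        ∑ t, (8 * H i t + (p t + q i t) / 16) :=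
      Finset.sum_le_sum_of_subset_of_nonneg (Finset.subset_univ _)
        (fun t _ _ => by have := hH0 i t; have := hp0 t; have := hq0 i t; positivity)
    simp only [Finset.sum_add_distrib, ← Finset.mul_sum, ← Finset.sum_div] at e8 e9
    rw [Finset.sum_sub_distrib] at e8
    have := hQ1 i
    have := hQ2 i
    rw [e1, e2]
    linarith
  -- upper bound for the Hellinger distance
  set u : ι → T → Fin m → ℝ := fun i t j => (ν i).real (R t j ∩ G) / ν₀.real (R t j ∩ G) with hu
  -- With `q = p * ∏ u`, the summand is `q - p + 2 * p * (1 - √(∏ u))`; on a null leaf it is just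
  -- `q`.
  have hHle : ∀ i t, H i t ≤ q i t - p t + ∑ j, p t * (1 - u i t j) +
      2 * (p t * ∑ j, (u i t j - 1) ^ 2) := by
    intro i t
    rcases (hp0 t).eq_or_lt with h0 | h0
    · rw [hH, ← h0]; simp
    · have hpos : ∀ j, 0 < ν₀.real (R t j ∩ G) := by
        intro j
        refine lt_of_le_of_ne measureReal_nonneg fun h => h0.ne' ?_
        exact Finset.prod_eq_zero (Finset.mem_univ j) h.symm
      have h1 := two_mul_one_sub_sqrt_prod_le Finset.univ (u := u i t)
        (fun j => (hA _ (hmR t j) Set.inter_subset_right (hpos j)).1 i)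
      have h2 : q i t = p t * ∏ j, u i t j := by
        simp only [hp, hq, hu, ← Finset.prod_mul_distrib]
        exact Finset.prod_congr rfl fun j _ => (mul_div_cancel₀ _ (hpos j).ne').symm
      have h3 : √(p t * q i t) = p t * √(∏ j, u i t j) := by
        rw [h2, ← mul_assoc, Real.sqrt_mul (by positivity), Real.sqrt_mul_self h0.le]
      have h4 := mul_le_mul_of_nonneg_left h1 h0.le
      rw [Finset.sum_add_distrib, mul_add, ← Finset.mul_sum, Finset.mul_sum _ _ (p t)] at h4
      rw [hH, h3]
      linarith
  -- Hybrid argument: `p t * u i t j` is the mass of the leaf when party `j` alone draws from `ν i`.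
  -- Summed over the partition, the difference is `(ν₀ G - ν i G) * ν₀ G ^ (m - 1)`.
  have hlin : ∀ i j, ∑ t, p t * (1 - u i t j) ≤ δ := by
    intro i j
    have h1 : ∀ t, p t * (1 - u i t j) =
        p t - ∏ k, ((Function.update (fun _ => ν₀) j (ν i)) k).real (R t k ∩ G) := by
      intro t
      rw [← Finset.mul_prod_erase _ _ (Finset.mem_univ j)]
      have h2 : ∏ k ∈ Finset.univ.erase j,
          ((Function.update (fun _ => ν₀) j (ν i)) k).real (R t k ∩ G) =
          ∏ k ∈ Finset.univ.erase j, ν₀.real (R t k ∩ G) :=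
        Finset.prod_congr rfl fun k hk => by rw [Function.update_of_ne (Finset.ne_of_mem_erase hk)]
      have h3 : p t = ν₀.real (R t j ∩ G) * ∏ k ∈ Finset.univ.erase j, ν₀.real (R t k ∩ G) :=
        (Finset.mul_prod_erase _ _ (Finset.mem_univ j)).symm
      rw [h2, h3, Function.update_self]
      simp only [hu]
      by_cases h0 : ν₀.real (R t j ∩ G) = 0
      · have : (ν i).real (R t j ∩ G) = 0 := by
          rw [measureReal_eq_zero_iff] at h0 ⊢
          exact hac i h0
        simp [h0, this]
      · field_simp
    rw [Finset.sum_congr rfl fun t _ => h1 t, Finset.sum_sub_distrib, hP,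
      htot _ (fun k => by
        by_cases hk : k = j
        · subst hk; simpa using inferInstanceAs (IsProbabilityMeasure (ν i))
        · simpa [Function.update_of_ne hk] using inferInstanceAs (IsProbabilityMeasure ν₀)),
      ← Finset.mul_prod_erase _ _ (Finset.mem_univ j), Function.update_self]
    have h2 : ∏ k ∈ Finset.univ.erase j, ((Function.update (fun _ => ν₀) j (ν i)) k).real G =
        ν₀.real G ^ (m - 1) := by
      rw [Finset.prod_congr rfl fun k hk => by
        rw [Function.update_of_ne (Finset.ne_of_mem_erase hk)]]
      simp
    have hm : ν₀.real G ^ m = ν₀.real G * ν₀.real G ^ (m - 1) := by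
      rw [← pow_succ', Nat.sub_add_cancel (Fin.pos j)]
    rw [h2, hm, ← sub_mul]
    have h3 : ν₀.real G ≤ 1 := measureReal_le_one
    have h4 : ν₀.real G ^ (m - 1) ≤ 1 := pow_le_one₀ measureReal_nonneg h3
    have h5 : 0 ≤ ν₀.real G ^ (m - 1) := pow_nonneg measureReal_nonneg _
    have h6 := hGi i
    calc _ ≤ δ * ν₀.real G ^ (m - 1) := mul_le_mul_of_nonneg_right (by linarith) h5
      _ ≤ δ := mul_le_of_le_one_right hδ0 h4
  have hHsum : ∀ i, ∑ t, H i t ≤ 2 * (m * δ) + 2 * ∑ t, p t * ∑ j, (u i t j - 1) ^ 2 := by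
    intro i
    have h1 := Finset.sum_le_sum fun t (_ : t ∈ Finset.univ) => hHle i t
    rw [Finset.sum_add_distrib, Finset.sum_add_distrib, Finset.sum_sub_distrib,
      Finset.sum_comm (f := fun t j => p t * (1 - u i t j)),
      ← Finset.mul_sum _ (fun t => p t * ∑ j, (u i t j - 1) ^ 2)] at h1
    have h2 := Finset.sum_le_sum fun j (_ : j ∈ Finset.univ) => hlin i j
    simp only [Finset.sum_const, Finset.card_univ, Fintype.card_fin, nsmul_eq_mul] at h2
    have := hQ2 i
    linarith
  -- For each leaf the hypothesis `hA` is applied to every party's side; the logarithms add up to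
  -- `-log (p t)`, and averaging yields the entropy of the transcript.
  have hent : ∑ i, ∑ t, p t * ∑ j, (u i t j - 1) ^ 2 ≤ K * (B + 1) := by
    rw [Finset.sum_comm]
    have h1 : ∀ t, ∑ i, p t * ∑ j, (u i t j - 1) ^ 2 ≤ K * Real.negMulLog (p t) := by
      intro t
      rcases (hp0 t).eq_or_lt with h0 | h0
      · simp [← h0]
      · have hpos : ∀ j, 0 < ν₀.real (R t j ∩ G) := by
          intro j
          refine lt_of_le_of_ne measureReal_nonneg fun h => h0.ne' ?_
          exact Finset.prod_eq_zero (Finset.mem_univ j) h.symm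
        rw [← Finset.mul_sum, Finset.sum_comm]
        have h2 : ∑ j, ∑ i, (u i t j - 1) ^ 2 ≤ ∑ j, K * -Real.log (ν₀.real (R t j ∩ G)) :=
          Finset.sum_le_sum fun j _ => (hA _ (hmR t j) Set.inter_subset_right (hpos j)).2
        have h3 : Real.log (p t) = ∑ j, Real.log (ν₀.real (R t j ∩ G)) :=
          Real.log_prod fun j _ => (hpos j).ne'
        rw [← Finset.mul_sum, Finset.sum_neg_distrib, ← h3] at h2
        calc _ ≤ p t * (K * -Real.log (p t)) := mul_le_mul_of_nonneg_left h2 h0.le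
          _ = _ := by rw [Real.negMulLog]; ring
    refine (Finset.sum_le_sum fun t _ => h1 t).trans ?_
    rw [← Finset.mul_sum]
    refine mul_le_mul_of_nonneg_left
      (sum_negMulLog_le_of_kraft p len B hp0 hP2 (fun t ht => ?_) hkraft) hK
    -- A leaf of positive mass is reached by some input, so its depth is at most `B`.
    have hne : ∀ j, (R t j).Nonempty := by
      intro j
      by_contra h
      rw [Set.not_nonempty_iff_eq_empty] at h
      exact ht.ne' (Finset.prod_eq_zero (Finset.mem_univ j) (by simp [h]))
    choose x hx using hne
    rw [← (hval x t hx).2]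
    exact hB x
  -- The constants: `3 / 8 = 1 / 2 - 1 / 8`, `17 = 1 + 8 * 2` and `16 = 8 * 2`.
  have hfin := hsep.trans (Finset.sum_le_sum fun i _ => hlow i)
  rw [Finset.sum_add_distrib, ← Finset.mul_sum] at hfin
  have h2 := Finset.sum_le_sum fun i (_ : i ∈ Finset.univ) => hHsum i
  rw [Finset.sum_add_distrib, ← Finset.mul_sum _ (fun i => ∑ t, p t * ∑ j, (u i t j - 1) ^ 2)] at h2
  simp only [Finset.sum_const, Finset.card_univ, nsmul_eq_mul] at hfin h2
  linarith

/-! ### Pointwise duality between entropy and squares -/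

/-- This is `log √h ≥ 1 - 1 / √h` multiplied by `2 * h`. -/
theorem sqrt_sub_one_sq_le_klFun {h : ℝ} (hh : 0 ≤ h) :
    (√h - 1) ^ 2 ≤ InformationTheory.klFun h := by
  rcases hh.eq_or_lt with h0 | h0
  · simp [← h0, InformationTheory.klFun_apply]
  have h1 := Real.one_sub_inv_le_log_of_pos (Real.sqrt_pos.2 h0)
  rw [Real.log_sqrt hh] at h1
  have hs := Real.sq_sqrt hh
  set s := √h
  have hs0 : 0 < s := Real.sqrt_pos.2 h0
  rw [InformationTheory.klFun_apply]
  have h2 := mul_le_mul_of_nonneg_left h1 (by positivity : 0 ≤ 2 * s ^ 2)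
  have h3 : 2 * s ^ 2 * (1 - s⁻¹) = 2 * s ^ 2 - 2 * s := by field_simp
  rw [h3, hs] at h2
  nlinarith

/-- For `h ≤ 2` factor `h - 1 = (√h - 1) * (√h + 1)` and use `(1 + √2) ^ 2 < 6`; beyond `2` the left
side stays `1`. -/
theorem min_sub_one_sq_le_klFun {h : ℝ} (hh : 0 ≤ h) :
    (min h 2 - 1) ^ 2 ≤ 6 * InformationTheory.klFun h := by
  refine le_trans ?_ (mul_le_mul_of_nonneg_left (sqrt_sub_one_sq_le_klFun hh) (by norm_num))
  have hs := Real.sq_sqrt hh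
  have hs0 : 0 ≤ √h := Real.sqrt_nonneg h
  set s := √h
  rcases le_total h 2 with h2 | h2
  · rw [min_eq_left h2, ← hs]
    have h3 : s ≤ 1.42 := by nlinarith
    nlinarith [mul_nonneg (sq_nonneg (s - 1)) (by nlinarith : 0 ≤ 6 - (s + 1) ^ 2)]
  · rw [min_eq_right h2]
    have h3 : 1.41 ≤ s := by nlinarith
    nlinarith

/-- Where the density is large, its excess is controlled linearly: `h - 2 ≤ 2 * (√h - 1) ^ 2`
amounts to `0 ≤ (√h - 2) ^ 2`. -/
theorem max_sub_two_le_klFun {h : ℝ} (hh : 0 ≤ h) :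
    max (h - 2) 0 ≤ 2 * InformationTheory.klFun h := by
  refine max_le ?_ (mul_nonneg zero_le_two (InformationTheory.klFun_nonneg hh))
  have := sqrt_sub_one_sq_le_klFun hh
  nlinarith [Real.sq_sqrt hh, sq_nonneg (√h - 2)]

/-- A pointwise duality between densities and test functions: the test function is paired
quadratically where the density is bounded, and by its bound `D` on the support elsewhere. -/
theorem mul_le_add_klFun {h l θ D : ℝ} (hh : 0 ≤ h) (hθ : 0 < θ) (hD0 : 0 ≤ D)
    (hD : h ≠ 0 → |l| ≤ D) :
    h * l ≤ l + (3 * θ + 2 * D) * InformationTheory.klFun h + (2 * θ)⁻¹ * l ^ 2 := by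
  have h1 := min_sub_one_sq_le_klFun hh
  have h2 := max_sub_two_le_klFun hh
  have h3 : h = min h 2 + max (h - 2) 0 := by
    rcases le_total h 2 with h4 | h4
    · rw [min_eq_left h4, max_eq_right (by linarith), add_zero]
    · rw [min_eq_right h4, max_eq_left (by linarith)]; ring
  have h4 : (min h 2 - 1) * l ≤ θ / 2 * (min h 2 - 1) ^ 2 + (2 * θ)⁻¹ * l ^ 2 := by
    have : θ / 2 * (min h 2 - 1) ^ 2 + (2 * θ)⁻¹ * l ^ 2 - (min h 2 - 1) * l =
        (2 * θ)⁻¹ * (θ * (min h 2 - 1) - l) ^ 2 := by field_simp; ring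
    have : 0 ≤ (2 * θ)⁻¹ * (θ * (min h 2 - 1) - l) ^ 2 := by positivity
    linarith
  have h5 : max (h - 2) 0 * l ≤ D * max (h - 2) 0 := by
    by_cases h0 : h = 0
    · simp [h0]
    · have := (le_abs_self l).trans (hD h0)
      rw [mul_comm]
      exact mul_le_mul_of_nonneg_right this (le_max_right _ _)
  have h6 : h * l = (min h 2 - 1) * l + l + max (h - 2) 0 * l := by
    nth_rewrite 1 [h3]; ring
  have h7 := mul_le_mul_of_nonneg_left h1 (by positivity : 0 ≤ θ / 2)
  have h8 := mul_le_mul_of_nonneg_left h2 hD0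
  linarith

/-! ### Bessel families: the entropy bound for one sample -/

/-- The entropy functional of a nonnegative function. -/
noncomputable def funEntropy {S : Type*} [MeasurableSpace S] (P : Measure S) (f : S → ℝ) : ℝ :=
  ∫ x, f x * Real.log (f x) ∂P - (∫ x, f x ∂P) * Real.log (∫ x, f x ∂P)

/-- A family of probability densities with respect to `P` whose deviations from `1` satisfy Bessel's
inequality with constant `s ^ 2`. -/
structure IsBesselFamily {S ι : Type*} [MeasurableSpace S] [Fintype ι] (P : Measure S)
    (L : ι → S → ℝ) (s : ℝ) : Prop where
  measurable : ∀ i, Measurable (L i)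
  nonneg : ∀ i x, 0 ≤ L i x
  memLp : ∀ i, MemLp (L i) 2 P
  integral_eq_one : ∀ i, ∫ x, L i x ∂P = 1
  bessel : ∀ a : ι → ℝ, ∫ x, (∑ i, a i * (L i x - 1)) ^ 2 ∂P ≤ s ^ 2 * ∑ i, a i ^ 2

theorem abs_mul_log_le_one {t : ℝ} (h0 : 0 ≤ t) (h1 : t ≤ 1) : |t * Real.log t| ≤ 1 := by
  rcases h0.eq_or_lt with h | h
  · simp [← h]
  · have := Real.abs_log_mul_self_lt t h h1
    rw [mul_comm]; exact this.le

theorem integrable_of_unit_interval {S : Type*} [MeasurableSpace S] {P : Measure S}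
    [IsFiniteMeasure P] {f : S → ℝ} (hf : Measurable f) (h0 : ∀ x, 0 ≤ f x) (h1 : ∀ x, f x ≤ 1) :
    Integrable f P :=
  Integrable.of_bound hf.aestronglyMeasurable 1
    (Filter.Eventually.of_forall fun x => by rw [Real.norm_of_nonneg (h0 x)]; exact h1 x)

theorem integrable_mul_log {S : Type*} [MeasurableSpace S] {P : Measure S}
    [IsFiniteMeasure P] {f : S → ℝ} (hf : Measurable f) (h0 : ∀ x, 0 ≤ f x) (h1 : ∀ x, f x ≤ 1) :
    Integrable (fun x => f x * Real.log (f x)) P :=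
  Integrable.of_bound (by fun_prop) 1
    (Filter.Eventually.of_forall fun x => abs_mul_log_le_one (h0 x) (h1 x))

theorem abs_sum_mul_le {ι : Type*} [Fintype ι] {a z : ι → ℝ} {α M : ℝ} (hα : 0 ≤ α)
    (ha : ∑ i, a i ^ 2 ≤ α ^ 2) (hM : 0 ≤ M) (hz : ∀ i, |z i| ≤ M) :
    |∑ i, a i * z i| ≤ α * (√(Fintype.card ι) * M) := by
  have h1 : (∑ i, a i * z i) ^ 2 ≤ (∑ i, a i ^ 2) * ∑ i, z i ^ 2 :=
    Finset.sum_mul_sq_le_sq_mul_sq _ _ _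
  have h2 : ∑ i, z i ^ 2 ≤ Fintype.card ι * M ^ 2 := by
    calc ∑ i, z i ^ 2 ≤ ∑ _i : ι, M ^ 2 :=
          Finset.sum_le_sum fun i _ => sq_le_sq' (abs_le.1 (hz i)).1 (abs_le.1 (hz i)).2
      _ = _ := by simp
  refine abs_le_of_sq_le_sq ?_ (by positivity)
  rw [mul_pow, mul_pow, Real.sq_sqrt (Nat.cast_nonneg _)]
  exact h1.trans (mul_le_mul ha h2 (Finset.sum_nonneg fun _ _ => sq_nonneg _) (sq_nonneg _))

namespace IsBesselFamily

variable {S ι : Type*} [MeasurableSpace S] [Fintype ι] {P : Measure S} [IsProbabilityMeasure P]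
  {L : ι → S → ℝ} {s : ℝ}

theorem integrable (hL : IsBesselFamily P L s) (i : ι) : Integrable (L i) P :=
  (hL.memLp i).integrable one_le_two

/-- One sample: the tilt of `f` towards the densities is controlled by the entropy of `f`. -/
theorem sum_mul_integral_le (hL : IsBesselFamily P L s) (hs : 0 < s) {M : ℝ} (hM : 0 ≤ M)
    {f : S → ℝ} (hf : Measurable f) (h0 : ∀ x, 0 ≤ f x) (h1 : ∀ x, f x ≤ 1)
    (hsupp : ∀ x, f x ≠ 0 → ∀ i, |L i x - 1| ≤ M) (a : ι → ℝ) {α r : ℝ} (hα : 0 < α) (hr : 0 < r)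
    (ha : ∑ i, a i ^ 2 ≤ α ^ 2) :
    ∑ i, a i * ∫ x, f x * (L i x - 1) ∂P ≤
      α * ((3 * s * r + 2 * (√(Fintype.card ι) * M)) * funEntropy P f + s / r * ∫ x, f x ∂P) := by
  have hfi := integrable_of_unit_interval (P := P) hf h0 h1
  have hLi : ∀ i, Integrable (fun x => L i x - 1) P := fun i => (hL.integrable i).sub
    (integrable_const _)
  have hfLi : ∀ i, Integrable (fun x => f x * (L i x - 1)) P := fun i =>
    (hLi i).bdd_mul (c := 1) hf.aestronglyMeasurable
      (Filter.Eventually.of_forall fun x => by rw [Real.norm_of_nonneg (h0 x)]; exact h1 x)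
  rcases (integral_nonneg h0 : 0 ≤ ∫ x, f x ∂P).eq_or_lt with hg | hg
  · have hae : f =ᵐ[P] 0 := (integral_eq_zero_iff_of_nonneg h0 hfi).1 hg.symm
    have e1 : ∀ i, ∫ x, f x * (L i x - 1) ∂P = 0 := fun i =>
      integral_eq_zero_of_ae (hae.mono fun x hx => by simp [hx])
    have e2 : ∫ x, f x * Real.log (f x) ∂P = 0 :=
      integral_eq_zero_of_ae (hae.mono fun x hx => by simp [hx])
    simp [e1, funEntropy, e2, ← hg]
  set g := ∫ x, f x ∂P with hgdef
  set Λ : S → ℝ := fun x => ∑ i, a i * (L i x - 1) with hΛ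
  have hΛi : Integrable Λ P := integrable_finsetSum _ fun i _ => (hLi i).const_mul _
  have hΛ2 : MemLp Λ 2 P := memLp_finsetSum _ fun i _ =>
    ((hL.memLp i).sub (memLp_const 1)).const_mul (a i)
  have hΛsq : Integrable (fun x => Λ x ^ 2) P := hΛ2.integrable_sq
  have hΛ0 : ∫ x, Λ x ∂P = 0 := by
    simp only [hΛ]
    rw [integral_finsetSum _ fun i _ => (hLi i).const_mul _]
    refine Finset.sum_eq_zero fun i _ => ?_
    rw [integral_const_mul, integral_sub (hL.integrable i) (integrable_const _),
      hL.integral_eq_one]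
    simp
  -- The uniform bound of `Λ` on the support of `f`, by Cauchy–Schwarz.
  set D := α * (√(Fintype.card ι) * M) with hD
  have hD0 : 0 ≤ D := by positivity
  -- With this weight Bessel's bound turns the quadratic term into `α * s / (2 * r)` times the mean
  -- of `f`; `r` stays free for optimization.
  set θ := r * s * α with hθ
  have hθ0 : 0 < θ := by positivity
  -- The duality is applied to the normalized density `f / g`. On integration the linear term
  -- vanishes and the `klFun` term becomes the entropy of `f`.
  have hpt : ∀ x, f x * Λ x ≤ g * Λ x + (3 * θ + 2 * D) *
      (f x * Real.log (f x) - f x * Real.log g + g - f x) + g * (2 * θ)⁻¹ * Λ x ^ 2 := by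
    intro x
    have h := mul_le_add_klFun (h := f x / g) (l := Λ x) (θ := θ) (D := D)
      (div_nonneg (h0 x) hg.le) hθ0 hD0
      (fun hx => abs_sum_mul_le hα.le ha hM (hsupp x fun h => hx (by simp [h])))
    have h2 := mul_le_mul_of_nonneg_left h hg.le
    have h3 : g * InformationTheory.klFun (f x / g) =
        f x * Real.log (f x) - f x * Real.log g + g - f x := by
      rw [InformationTheory.klFun_apply]
      by_cases hx : f x = 0
      · simp [hx]
      · rw [Real.log_div hx hg.ne']; field_simp
    have h4 : g * (f x / g * Λ x) = f x * Λ x := by field_simp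
    rw [h4] at h2
    rw [← h3]
    linarith
  have hflog := integrable_mul_log (P := P) hf h0 h1
  have hsum : ∑ i, a i * ∫ x, f x * (L i x - 1) ∂P = ∫ x, f x * Λ x ∂P := by
    simp only [hΛ, Finset.mul_sum]
    rw [integral_finsetSum]
    · refine Finset.sum_congr rfl fun i _ => ?_
      rw [← integral_const_mul]
      exact integral_congr_ae (Filter.Eventually.of_forall fun x => by ring)
    · intro i _
      exact ((hfLi i).const_mul (a i)).congr (Filter.Eventually.of_forall fun x => by ring)
  have hfΛ : Integrable (fun x => f x * Λ x) P :=
    hΛi.bdd_mul (c := 1) hf.aestronglyMeasurable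
      (Filter.Eventually.of_forall fun x => by rw [Real.norm_of_nonneg (h0 x)]; exact h1 x)
  have hi1 : Integrable (fun x => f x * Real.log (f x) - f x * Real.log g + g - f x) P :=
    ((hflog.sub (hfi.mul_const _)).add (integrable_const _)).sub hfi
  have hi2 : Integrable (fun x => g * Λ x + (3 * θ + 2 * D) *
      (f x * Real.log (f x) - f x * Real.log g + g - f x)) P :=
    (hΛi.const_mul g).add (hi1.const_mul (3 * θ + 2 * D))
  have hi3 : Integrable (fun x => f x * Real.log (f x) - f x * Real.log g) P :=
    hflog.sub (hfi.mul_const _)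
  have hi4 : Integrable (fun x => f x * Real.log (f x) - f x * Real.log g + g) P :=
    hi3.add (integrable_const _)
  have hi5 : Integrable (fun x => g * (2 * θ)⁻¹ * Λ x ^ 2) P := hΛsq.const_mul _
  have hint := integral_mono hfΛ (hi2.add hi5) hpt
  rw [integral_add' hi2 hi5, integral_add (hΛi.const_mul g) (hi1.const_mul (3 * θ + 2 * D)),
    integral_const_mul, integral_const_mul, integral_const_mul, hΛ0, integral_sub hi4 hfi,
    integral_add hi3 (integrable_const _), integral_sub hflog (hfi.mul_const _),
    integral_mul_const, ← hgdef] at hint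
  simp only [integral_const, probReal_univ, smul_eq_mul, one_mul] at hint
  have hb : ∫ x, Λ x ^ 2 ∂P ≤ s ^ 2 * α ^ 2 :=
    (hL.bessel a).trans (mul_le_mul_of_nonneg_left ha (sq_nonneg s))
  have hb2 := mul_le_mul_of_nonneg_left hb (by positivity : 0 ≤ g * (2 * θ)⁻¹)
  have hb3 : g * (2 * θ)⁻¹ * (s ^ 2 * α ^ 2) = α * (s / r * g) / 2 := by
    rw [hθ]; field_simp
  have hb4 : 0 ≤ α * (s / r * g) := by positivity
  rw [hsum, funEntropy, ← hgdef]
  have e : α * ((3 * s * r + 2 * (√(Fintype.card ι) * M)) *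
      (∫ x, f x * Real.log (f x) ∂P - g * Real.log g) + s / r * g) =
      (3 * θ + 2 * D) * (∫ x, f x * Real.log (f x) ∂P - g * Real.log g) + α * (s / r * g) := by
    rw [hθ, hD]; ring
  rw [e]
  linarith

end IsBesselFamily

/-! ### Several samples: induction by the chain rule of entropy -/

/-- The likelihood ratio of a sample, restricted to the indices from `k` on. -/
noncomputable def suffixLik {S ι : Type*} (L : ι → S → ℝ) (i : ι) {n : ℕ} (k : ℕ)
    (x : Fin n → S) : ℝ :=
  ∏ t : Fin n, if k ≤ (t : ℕ) then L i (x t) else 1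

theorem suffixLik_zero {S ι : Type*} (L : ι → S → ℝ) (i : ι) {n : ℕ} (x : Fin n → S) :
    suffixLik L i 0 x = ∏ t, L i (x t) := by
  simp [suffixLik]

theorem suffixLik_succ_cons {S ι : Type*} (L : ι → S → ℝ) (i : ι) {n : ℕ} (k : ℕ)
    (z : S) (y : Fin n → S) :
    suffixLik L i (k + 1) (Fin.cons z y : Fin (n + 1) → S) = suffixLik L i k y := by
  simp [suffixLik, Fin.prod_univ_succ]

/-- Samples whose one-point likelihood ratios are within `M` of `1`, and whose suffixes have
likelihood ratio at most `2`. -/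
def IsTame {S ι : Type*} (L : ι → S → ℝ) (M : ℝ) {n : ℕ} (x : Fin n → S) : Prop :=
  ∀ i, (∀ t, |L i (x t) - 1| ≤ M) ∧ ∀ k, suffixLik L i k x ≤ 2

/-- Tameness is formulated with suffixes since the induction on the number of samples strips them
off from the front. -/
theorem IsTame.of_cons {S ι : Type*} {L : ι → S → ℝ} {M : ℝ} {n : ℕ} {z : S} {y : Fin n → S}
    (h : IsTame L M (Fin.cons z y : Fin (n + 1) → S)) :
    IsTame L M y ∧ ∀ i, |L i z - 1| ≤ M := by
  refine ⟨fun i => ⟨fun t => ?_, fun k => ?_⟩, fun i => ?_⟩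
  · simpa using (h i).1 t.succ
  · rw [← suffixLik_succ_cons L i k z y]; exact (h i).2 (k + 1)
  · simpa using (h i).1 0

section Fubini

variable {S : Type*} [MeasurableSpace S] {P : Measure S} [IsProbabilityMeasure P] {n : ℕ}

theorem measurePreserving_finCons (P : Measure S) [IsProbabilityMeasure P] (n : ℕ) :
    MeasurePreserving (fun p : S × (Fin n → S) => (Fin.cons p.1 p.2 : Fin (n + 1) → S))
      (P.prod (Measure.pi fun _ => P)) (Measure.pi fun _ => P) := by
  have h := (measurePreserving_piFinSuccAbove (fun _ : Fin (n + 1) => P) 0).symm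
  convert h using 1
  ext p : 1
  simp [MeasurableEquiv.piFinSuccAbove, Fin.insertNthEquiv]

theorem integrable_comp_finCons {F : (Fin (n + 1) → S) → ℝ}
    (hF : Integrable F (Measure.pi fun _ => P)) :
    Integrable (fun p : S × (Fin n → S) => F (Fin.cons p.1 p.2)) (P.prod (Measure.pi fun _ => P)) :=
  (measurePreserving_finCons P n).integrable_comp_of_integrable hF

theorem integrable_integral_finCons {F : (Fin (n + 1) → S) → ℝ}
    (hF : Integrable F (Measure.pi fun _ => P)) :
    Integrable (fun y : Fin n → S => ∫ z, F (Fin.cons z y) ∂P) (Measure.pi fun _ => P) :=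
  (integrable_comp_finCons hF).integral_prod_right

theorem integral_eq_integral_finCons {F : (Fin (n + 1) → S) → ℝ}
    (hF : Integrable F (Measure.pi fun _ => P)) :
    ∫ x, F x ∂(Measure.pi fun _ => P) =
      ∫ y, ∫ z, F (Fin.cons z y) ∂P ∂(Measure.pi fun _ : Fin n => P) := by
  rw [← integral_prod_symm _ (integrable_comp_finCons hF), ← (measurePreserving_finCons P n).map_eq,
    integral_map (measurePreserving_finCons P n).measurable.aemeasurable]
  rw [(measurePreserving_finCons P n).map_eq]
  exact hF.aestronglyMeasurable

end Fubini

namespace IsBesselFamily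

variable {S ι : Type*} [MeasurableSpace S] [Fintype ι] {P : Measure S} [IsProbabilityMeasure P]
  {L : ι → S → ℝ} {s : ℝ}

theorem integrable_prod (hL : IsBesselFamily P L s) (i : ι) (n : ℕ) :
    Integrable (fun x : Fin n → S => ∏ t, L i (x t)) (Measure.pi fun _ => P) :=
  Integrable.fintype_prod fun _ => hL.integrable i

theorem integrable_mul_prod_sub_one (hL : IsBesselFamily P L s) (i : ι) {n : ℕ}
    {f : (Fin n → S) → ℝ} (hf : Measurable f) (h0 : ∀ x, 0 ≤ f x) (h1 : ∀ x, f x ≤ 1) :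
    Integrable (fun x => f x * (∏ t, L i (x t) - 1)) (Measure.pi fun _ => P) :=
  ((hL.integrable_prod i n).sub (integrable_const _)).bdd_mul (c := 1) hf.aestronglyMeasurable
    (Filter.Eventually.of_forall fun x => by rw [Real.norm_of_nonneg (h0 x)]; exact h1 x)

/-- Several samples: the tilt of `f` towards the product densities is controlled by the entropy
of `f`. -/
theorem sum_mul_integral_pi_le (hL : IsBesselFamily P L s) (hs : 0 < s) {M : ℝ} (hM : 0 ≤ M)
    {r : ℝ} (hr : 0 < r) (a : ι → ℝ) {α : ℝ} (hα : 0 < α) (ha : ∑ i, a i ^ 2 ≤ α ^ 2) (n : ℕ) :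
    ∀ {f : (Fin n → S) → ℝ}, Measurable f → (∀ x, 0 ≤ f x) → (∀ x, f x ≤ 1) →
      (∀ x, f x ≠ 0 → IsTame L M x) →
    ∑ i, a i * ∫ x, f x * (∏ t, L i (x t) - 1) ∂(Measure.pi fun _ => P) ≤
      2 * α * ((3 * s * r + 2 * (√(Fintype.card ι) * M)) * funEntropy (Measure.pi fun _ => P) f +
        s / r * n * ∫ x, f x ∂(Measure.pi fun _ => P)) := by
  induction n with
  | zero =>
    intro f hf h0 h1 hsupp
    have : funEntropy (Measure.pi fun _ : Fin 0 => P) f = 0 := by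
      simp [funEntropy, integral_unique]
    simp [this]
  | succ n ih =>
    intro f hf h0 h1 hsupp
    set μ := Measure.pi fun _ : Fin n => P with hμ
    set μ' := Measure.pi fun _ : Fin (n + 1) => P with hμ'
    have hfi : Integrable f μ' := integrable_of_unit_interval hf h0 h1
    have hcm : Measurable fun p : S × (Fin n → S) => f (Fin.cons p.1 p.2) :=
      hf.comp (measurePreserving_finCons P n).measurable
    have hcm' : ∀ y : Fin n → S, Measurable fun z => f (Fin.cons z y) := fun y =>
      hcm.comp (by fun_prop : Measurable fun z : S => (z, y))
    set g : (Fin n → S) → ℝ := fun y => ∫ z, f (Fin.cons z y) ∂P with hg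
    have hgm : Measurable g := hcm.stronglyMeasurable.integral_prod_left'.measurable
    have hg0 : ∀ y, 0 ≤ g y := fun y => integral_nonneg fun z => h0 _
    have hg1 : ∀ y, g y ≤ 1 := fun y => by
      calc g y ≤ ∫ _z, (1 : ℝ) ∂P := integral_mono
            (integrable_of_unit_interval (hcm' y) (fun _ => h0 _) (fun _ => h1 _))
            (integrable_const _) (fun z => h1 _)
        _ = 1 := by simp
    have hgsupp : ∀ y, g y ≠ 0 → ∃ z, f (Fin.cons z y) ≠ 0 := by
      intro y hy
      by_contra! h
      exact hy (by simp [hg, h])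
    have hflog := integrable_mul_log (P := μ') hf h0 h1
    have hglog := integrable_mul_log (P := μ) hgm hg0 hg1
    have hgi : Integrable g μ := integrable_of_unit_interval hgm hg0 hg1
    have hfg : ∫ x, f x ∂μ' = ∫ y, g y ∂μ := integral_eq_integral_finCons hfi
    -- splitting off the first sample
    have hinner : ∀ i y, ∫ z, f (Fin.cons z y) *
        (∏ t, L i ((Fin.cons z y : Fin (n + 1) → S) t) - 1) ∂P =
        (∏ t, L i (y t)) * (∫ z, f (Fin.cons z y) * (L i z - 1) ∂P) +
          g y * (∏ t, L i (y t) - 1) := by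
      intro i y
      have hb : Integrable (fun z => f (Fin.cons z y) * (L i z - 1)) P :=
        ((hL.integrable i).sub (integrable_const _)).bdd_mul (c := 1)
          (hcm' y).aestronglyMeasurable
          (Filter.Eventually.of_forall fun x => by rw [Real.norm_of_nonneg (h0 _)]; exact h1 _)
      have hb' : Integrable (fun z => f (Fin.cons z y)) P :=
        integrable_of_unit_interval (hcm' y) (fun _ => h0 _) (fun _ => h1 _)
      rw [← integral_const_mul, hg, ← integral_mul_const,
        ← integral_add (hb.const_mul _) (hb'.mul_const _)]
      refine integral_congr_ae (Filter.Eventually.of_forall fun z => ?_)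
      simp only [Fin.prod_univ_succ, Fin.cons_zero, Fin.cons_succ]
      ring
    have hFi := fun i => hL.integrable_mul_prod_sub_one i hf h0 h1
    have hGi := fun i => hL.integrable_mul_prod_sub_one i hgm hg0 hg1
    have hψi : ∀ i, Integrable (fun y => (∏ t, L i (y t)) *
        (∫ z, f (Fin.cons z y) * (L i z - 1) ∂P)) μ := by
      intro i
      refine ((integrable_integral_finCons (hFi i)).sub (hGi i)).congr
        (Filter.Eventually.of_forall fun y => ?_)
      simp only [Pi.sub_apply, hinner]
      ring
    have hsplit : ∑ i, a i * ∫ x, f x * (∏ t, L i (x t) - 1) ∂μ' =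
        ∫ y, ∑ i, a i * ((∏ t, L i (y t)) * (∫ z, f (Fin.cons z y) * (L i z - 1) ∂P)) ∂μ +
        ∑ i, a i * ∫ y, g y * (∏ t, L i (y t) - 1) ∂μ := by
      rw [integral_finsetSum _ fun i _ => (hψi i).const_mul (a i), ← Finset.sum_add_distrib]
      refine Finset.sum_congr rfl fun i _ => ?_
      rw [integral_const_mul, ← mul_add, ← integral_add (hψi i) (hGi i),
        integral_eq_integral_finCons (hFi i)]
      congr 1
      exact integral_congr_ae (Filter.Eventually.of_forall fun y => hinner i y)
    set c := 3 * s * r + 2 * (√(Fintype.card ι) * M) with hc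
    have hpt : ∀ y, ∑ i, a i * ((∏ t, L i (y t)) * (∫ z, f (Fin.cons z y) * (L i z - 1) ∂P)) ≤
        2 * α * (c * (∫ z, f (Fin.cons z y) * Real.log (f (Fin.cons z y)) ∂P -
          g y * Real.log (g y)) + s / r * g y) := by
      intro y
      by_cases hy : ∃ z, f (Fin.cons z y) ≠ 0
      · obtain ⟨z, hz⟩ := hy
        have htame := ((hsupp _ hz).of_cons).1
        have hlik : ∀ i, (∏ t, L i (y t)) ^ 2 ≤ 4 := by
          intro i
          have h2 := (htame i).2 0
          rw [suffixLik_zero] at h2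
          have h3 : 0 ≤ ∏ t, L i (y t) := Finset.prod_nonneg fun t _ => hL.nonneg i _
          nlinarith
        -- The likelihood ratios of the later samples serve as weights in the one-sample bound.
        -- Being at most `2`, they at most double the norm of `a`, whence the factor `2` in the
        -- claim.
        have ha' : ∑ i, (a i * ∏ t, L i (y t)) ^ 2 ≤ (2 * α) ^ 2 := by
          calc ∑ i, (a i * ∏ t, L i (y t)) ^ 2 ≤ ∑ i, a i ^ 2 * 4 :=
                Finset.sum_le_sum fun i _ => by
                  rw [mul_pow]; exact mul_le_mul_of_nonneg_left (hlik i) (sq_nonneg _)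
            _ ≤ (2 * α) ^ 2 := by rw [← Finset.sum_mul]; linarith
        have := hL.sum_mul_integral_le hs hM (hcm' y) (fun _ => h0 _) (fun _ => h1 _)
          (fun z hz => ((hsupp _ hz).of_cons).2) (fun i => a i * ∏ t, L i (y t))
          (by positivity : 0 < 2 * α) hr ha'
        refine le_trans (le_of_eq (Finset.sum_congr rfl fun i _ => (mul_assoc _ _ _).symm)) ?_
        exact this
      · push Not at hy
        simp [hy, hg]
    have hEi : Integrable (fun y => c * (∫ z, f (Fin.cons z y) * Real.log (f (Fin.cons z y)) ∂P -
          g y * Real.log (g y))) μ := ((integrable_integral_finCons hflog).sub hglog).const_mul c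
    have hψ := integral_mono (integrable_finsetSum _ fun i _ => (hψi i).const_mul (a i))
      ((hEi.add (hgi.const_mul (s / r))).const_mul (2 * α)) hpt
    rw [integral_const_mul] at hψ
    rw [integral_add' hEi (hgi.const_mul (s / r)), integral_const_mul, integral_const_mul,
      integral_sub (integrable_integral_finCons hflog) hglog,
      ← integral_eq_integral_finCons hflog] at hψ
    have hih := ih hgm hg0 hg1 (fun y hy => by
      obtain ⟨z, hz⟩ := hgsupp y hy
      exact ((hsupp _ hz).of_cons).1)
    rw [hsplit]
    unfold funEntropy at hih ⊢
    rw [hfg]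
    push_cast
    -- Chain rule: the entropy of `f` is the mean entropy in the first sample plus the entropy of
    -- the marginal `g`, so the entropies of `g` cancel here.
    refine (add_le_add hψ hih).trans (le_of_eq ?_)
    ring

end IsBesselFamily

/-! ### Likelihood ratios of events -/

theorem lintegral_pi_prod_eq {ι S : Type*} [Fintype ι] [MeasurableSpace S] (P : Measure S)
    [IsProbabilityMeasure P] {f : ι → S → ℝ≥0∞} (hf : ∀ i, Measurable (f i)) :
    ∫⁻ x, ∏ i, f i (x i) ∂(Measure.pi fun _ : ι => P) = ∏ i, ∫⁻ z, f i z ∂P := by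
  rw [lintegral_prod_eq_prod_lintegral_of_indepFun Finset.univ (fun i (x : ι → S) => f i (x i))
    (iIndepFun_pi fun i => (hf i).aemeasurable) (fun i => (hf i).comp (measurable_pi_apply i))]
  refine Finset.prod_congr rfl fun i _ => ?_
  exact (measurePreserving_eval (fun _ : ι => P) i).lintegral_comp (hf i)

theorem pi_withDensity_eq {ι S : Type*} [Fintype ι] [MeasurableSpace S] (P : Measure S)
    [IsProbabilityMeasure P] {f : S → ℝ≥0∞} (hf : Measurable f)
    [IsProbabilityMeasure (P.withDensity f)] :
    (Measure.pi fun _ : ι => P.withDensity f) =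
      (Measure.pi fun _ : ι => P).withDensity fun x => ∏ i, f (x i) := by
  refine Measure.pi_eq fun s hs => ?_
  rw [withDensity_apply _ (MeasurableSet.univ_pi hs), ← lintegral_indicator
    (MeasurableSet.univ_pi hs)]
  have h : ∀ x : ι → S, (Set.univ.pi s).indicator (fun x => ∏ i, f (x i)) x =
      ∏ i, (s i).indicator f (x i) := by
    intro x
    by_cases hx : x ∈ Set.univ.pi s
    · rw [Set.indicator_of_mem hx]
      exact Finset.prod_congr rfl fun i _ => (Set.indicator_of_mem (hx i trivial) _).symm
    · rw [Set.indicator_of_notMem hx]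
      simp only [Set.mem_pi, Set.mem_univ, true_imp_iff, not_forall] at hx
      obtain ⟨i, hi⟩ := hx
      exact (Finset.prod_eq_zero (Finset.mem_univ i) (Set.indicator_of_notMem hi _)).symm
  simp_rw [h]
  rw [lintegral_pi_prod_eq P (fun i => hf.indicator (hs i))]
  refine Finset.prod_congr rfl fun i _ => ?_
  rw [lintegral_indicator (hs i), withDensity_apply _ (hs i)]

namespace IsBesselFamily

variable {S ι : Type*} [MeasurableSpace S] [Fintype ι] {P : Measure S} [IsProbabilityMeasure P]
  {L : ι → S → ℝ} {s : ℝ}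

theorem isProbabilityMeasure_withDensity (hL : IsBesselFamily P L s) (i : ι) :
    IsProbabilityMeasure (P.withDensity fun x => ENNReal.ofReal (L i x)) := by
  constructor
  rw [withDensity_apply _ MeasurableSet.univ, Measure.restrict_univ,
    ← ofReal_integral_eq_lintegral_ofReal (hL.integrable i)
      (Filter.Eventually.of_forall (hL.nonneg i)), hL.integral_eq_one, ENNReal.ofReal_one]

theorem pi_withDensity (hL : IsBesselFamily P L s) (i : ι) (n : ℕ) :
    (Measure.pi fun _ : Fin n => P.withDensity fun x => ENNReal.ofReal (L i x)) =
      (Measure.pi fun _ : Fin n => P).withDensity fun x => ENNReal.ofReal (∏ t, L i (x t)) := by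
  have := hL.isProbabilityMeasure_withDensity i
  rw [pi_withDensity_eq P (hL.measurable i).ennreal_ofReal]
  congr 1
  ext x
  rw [ENNReal.ofReal_prod_of_nonneg fun t _ => hL.nonneg i _]

theorem pi_real_eq_setIntegral (hL : IsBesselFamily P L s) (i : ι) {n : ℕ} {A : Set (Fin n → S)}
    (hA : MeasurableSet A) :
    (Measure.pi fun _ : Fin n => P.withDensity fun x => ENNReal.ofReal (L i x)).real A =
      ∫ x in A, ∏ t, L i (x t) ∂(Measure.pi fun _ => P) := by
  rw [Measure.real, hL.pi_withDensity, withDensity_apply _ hA,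
    ← ofReal_integral_eq_lintegral_ofReal (hL.integrable_prod i n).integrableOn
      (Filter.Eventually.of_forall fun x => Finset.prod_nonneg fun t _ => hL.nonneg i _),
    ENNReal.toReal_ofReal]
  exact integral_nonneg fun x => Finset.prod_nonneg fun t _ => hL.nonneg i _

theorem integral_indicator_mul_prod_sub_one (hL : IsBesselFamily P L s) (i : ι) {n : ℕ}
    {A : Set (Fin n → S)} (hA : MeasurableSet A) :
    ∫ x, A.indicator (fun _ => (1 : ℝ)) x * (∏ t, L i (x t) - 1) ∂(Measure.pi fun _ => P) =
      (Measure.pi fun _ : Fin n => P.withDensity fun x => ENNReal.ofReal (L i x)).real A -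
        (Measure.pi fun _ : Fin n => P).real A := by
  rw [hL.pi_real_eq_setIntegral i hA]
  have : ∀ x : Fin n → S, A.indicator (fun _ => (1 : ℝ)) x * (∏ t, L i (x t) - 1) =
      A.indicator (fun x => ∏ t, L i (x t) - 1) x := by
    intro x
    by_cases hx : x ∈ A <;> simp [hx]
  simp_rw [this]
  rw [integral_indicator hA, integral_sub (hL.integrable_prod i n).integrableOn
    (integrable_const _)]
  simp [Measure.real]

/-- Likelihood ratios of a set of tame samples, in terms of the information of the set. -/
theorem sum_likelihood_sub_one_sq_le (hL : IsBesselFamily P L s) (hs : 0 < s) {M : ℝ} (hM : 0 ≤ M)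
    {n : ℕ} (hn : 1 ≤ n) {A : Set (Fin n → S)} (hA : MeasurableSet A)
    (htame : ∀ x ∈ A, IsTame L M x) (hpos : 0 < (Measure.pi fun _ : Fin n => P).real A) :
    ∑ i, ((Measure.pi fun _ : Fin n => P.withDensity fun x => ENNReal.ofReal (L i x)).real A /
        (Measure.pi fun _ : Fin n => P).real A - 1) ^ 2 ≤
      128 * s ^ 2 * n * -Real.log ((Measure.pi fun _ : Fin n => P).real A) +
        32 * Fintype.card ι * M ^ 2 * Real.log ((Measure.pi fun _ : Fin n => P).real A) ^ 2 := by
  set p := (Measure.pi fun _ : Fin n => P).real A with hp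
  set u : ι → ℝ := fun i =>
    (Measure.pi fun _ : Fin n => P.withDensity fun x => ENNReal.ofReal (L i x)).real A / p with hu
  have hp1 : p ≤ 1 := measureReal_le_one
  obtain ⟨κ, hκ⟩ : ∃ κ, κ = -Real.log p := ⟨_, rfl⟩
  have hκ0 : 0 ≤ κ := by rw [hκ, neg_nonneg]; exact Real.log_nonpos hpos.le hp1
  have hlog : Real.log p = -κ := by rw [hκ, neg_neg]
  rw [hlog, neg_neg, neg_sq]
  have hn0 : (0 : ℝ) < n := by exact_mod_cast hn
  have hN0 : (0 : ℝ) ≤ Fintype.card ι := Nat.cast_nonneg _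
  rcases (Finset.sum_nonneg fun i _ => sq_nonneg (u i - 1) :
    0 ≤ ∑ i, (u i - 1) ^ 2).eq_or_lt with h0 | h0
  · rw [← h0]; positivity
  set α := √(∑ i, (u i - 1) ^ 2) with hα
  have hα0 : 0 < α := Real.sqrt_pos.2 h0
  have hα2 : α ^ 2 = ∑ i, (u i - 1) ^ 2 := Real.sq_sqrt h0.le
  -- The bound for functions is tested with the indicator of `A`, of entropy `p * κ`, and with the
  -- deviation vector `u - 1` itself as coefficients; then `p * α` cancels.
  have key : ∀ r : ℝ, 0 < r →
      α ≤ 2 * ((3 * s * r + 2 * (√(Fintype.card ι) * M)) * κ + s / r * n) := by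
    intro r hr
    have h := hL.sum_mul_integral_pi_le hs hM hr (fun i => u i - 1) hα0 hα2.ge n
      (f := A.indicator fun _ => 1) (measurable_const.indicator hA)
      (fun x => Set.indicator_nonneg (fun _ _ => zero_le_one) _)
      (fun x => Set.indicator_le_self' (fun _ _ => zero_le_one) _)
      (fun x hx => htame x (Set.mem_of_indicator_ne_zero hx))
    have h1 : ∫ x, A.indicator (fun _ => (1 : ℝ)) x ∂(Measure.pi fun _ => P) = p := by
      rw [integral_indicator hA]; simp [hp, Measure.real]
    have h2 : funEntropy (Measure.pi fun _ : Fin n => P) (A.indicator fun _ => (1 : ℝ)) =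
        p * κ := by
      have : ∀ x, A.indicator (fun _ => (1 : ℝ)) x *
          Real.log (A.indicator (fun _ => (1 : ℝ)) x) = 0 := by
        intro x
        by_cases hx : x ∈ A <;> simp [hx]
      simp only [funEntropy, this, h1]
      simp [hlog]
    have h3 : ∀ i, ∫ x, A.indicator (fun _ => (1 : ℝ)) x * (∏ t, L i (x t) - 1)
        ∂(Measure.pi fun _ => P) = p * (u i - 1) := by
      intro i
      rw [hL.integral_indicator_mul_prod_sub_one i hA, ← hp, hu]
      field_simp
    simp only [h3, h2, h1] at h
    have h4 : ∑ i, (u i - 1) * (p * (u i - 1)) = p * α * α := by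
      rw [mul_assoc, ← sq, hα2, Finset.mul_sum]
      exact Finset.sum_congr rfl fun i _ => by ring
    rw [h4] at h
    have h5 : p * α * α ≤ p * α *
        (2 * ((3 * s * r + 2 * (√(Fintype.card ι) * M)) * κ + s / r * n)) := by
      refine h.trans (le_of_eq ?_); ring
    exact le_of_mul_le_mul_left h5 (by positivity)
  rw [← hα2]
  rcases hκ0.eq_or_lt with hk | hk
  -- An event of full measure carries no information. A large `r` then gives `α ≤ α / 2`,
  -- contradicting `0 < α`.
  · exfalso
    have := key (4 * s * n / α) (by positivity)
    rw [← hk] at this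
    have e : s / (4 * s * n / α) * n = α / 4 := by field_simp
    rw [e] at this
    linarith
  -- This `r` balances `s * r * κ` against `s * n / r`, both becoming `s * √(n * κ)`.
  · have h1 := key (√n / √κ) (by positivity)
    have hsn := Real.sq_sqrt hn0.le
    have hsk := Real.sq_sqrt hk.le
    have hsN := Real.sq_sqrt hN0
    have hn1 : 0 < √(n : ℝ) := by positivity
    have hk1 : 0 < √κ := by positivity
    set a := √(n : ℝ)
    set c := √κ
    set N := √(Fintype.card ι : ℝ)
    have e1 : (3 * s * (a / c) + 2 * (N * M)) * κ + s / (a / c) * n =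
        4 * (s * a * c) + 2 * (N * M * κ) := by
      rw [← hsn, ← hsk]; field_simp; ring
    rw [e1] at h1
    have h2 : α ^ 2 ≤ (2 * (4 * (s * a * c) + 2 * (N * M * κ))) ^ 2 :=
      pow_le_pow_left₀ hα0.le h1 2
    have h3 : (s * a * c) ^ 2 = s ^ 2 * n * κ := by rw [mul_pow, mul_pow, hsn, hsk]
    have h4 : (N * M * κ) ^ 2 = Fintype.card ι * M ^ 2 * κ ^ 2 := by
      rw [mul_pow, mul_pow, hsN]
    nlinarith [sq_nonneg (8 * (s * a * c) - 4 * (N * M * κ))]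

/-- The likelihood ratio of an event is the mean over it of the pointwise likelihood ratio. -/
theorem abs_likelihood_sub_one_le (hL : IsBesselFamily P L s) {n : ℕ} {A : Set (Fin n → S)}
    (hA : MeasurableSet A) {b : ℝ} {i : ι} (hb : ∀ x ∈ A, |∏ t, L i (x t) - 1| ≤ b)
    (hpos : 0 < (Measure.pi fun _ : Fin n => P).real A) :
    |(Measure.pi fun _ : Fin n => P.withDensity fun x => ENNReal.ofReal (L i x)).real A /
        (Measure.pi fun _ : Fin n => P).real A - 1| ≤ b := by
  have h := hL.pi_real_eq_setIntegral i hA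
  have hi : IntegrableOn (fun x : Fin n → S => ∏ t, L i (x t)) A (Measure.pi fun _ => P) :=
    (hL.integrable_prod i n).integrableOn
  have h1 : ∫ x in A, (∏ t, L i (x t) - 1) ∂(Measure.pi fun _ => P) =
      (Measure.pi fun _ : Fin n => P.withDensity fun x => ENNReal.ofReal (L i x)).real A -
        (Measure.pi fun _ : Fin n => P).real A := by
    rw [integral_sub hi (integrable_const _), h]; simp [Measure.real]
  have h2 := norm_setIntegral_le_of_norm_le_const (μ := Measure.pi fun _ : Fin n => P)
    (measure_lt_top _ A) (f := fun x => ∏ t, L i (x t) - 1) hb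
  rw [h1, Real.norm_eq_abs] at h2
  have h3 : ∀ x : ℝ, x / (Measure.pi fun _ : Fin n => P).real A - 1 =
      (x - (Measure.pi fun _ : Fin n => P).real A) / (Measure.pi fun _ : Fin n => P).real A := by
    intro x; field_simp
  rw [h3, abs_div, abs_of_pos hpos, div_le_iff₀ hpos]
  exact h2

/-- The bound must be linear in the information `κ` to add up over the parties. While `κ` is at most
the number of indices, one factor of `κ ^ 2` is replaced by that number. For larger `κ` the trivial
bound `b ^ 2` for each index suffices. -/
theorem sum_likelihood_sub_one_sq_le_mul_neg_log (hL : IsBesselFamily P L s) (hs : 0 < s) {M : ℝ}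
    (hM : 0 ≤ M) {n : ℕ} (hn : 1 ≤ n) {A : Set (Fin n → S)} (hA : MeasurableSet A)
    (htame : ∀ x ∈ A, IsTame L M x) {b : ℝ} (hb : ∀ x ∈ A, ∀ i, |∏ t, L i (x t) - 1| ≤ b)
    (hpos : 0 < (Measure.pi fun _ : Fin n => P).real A) :
    ∑ i, ((Measure.pi fun _ : Fin n => P.withDensity fun x => ENNReal.ofReal (L i x)).real A /
        (Measure.pi fun _ : Fin n => P).real A - 1) ^ 2 ≤
      (128 * s ^ 2 * n + 32 * Fintype.card ι ^ 2 * M ^ 2 + b ^ 2) *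
        -Real.log ((Measure.pi fun _ : Fin n => P).real A) := by
  have h1 := hL.sum_likelihood_sub_one_sq_le hs hM hn hA htame hpos
  set p := (Measure.pi fun _ : Fin n => P).real A with hp
  have hk : 0 ≤ -Real.log p := by rw [neg_nonneg]; exact Real.log_nonpos hpos.le measureReal_le_one
  have hN : (0 : ℝ) ≤ Fintype.card ι := Nat.cast_nonneg _
  rcases le_total (-Real.log p) (Fintype.card ι) with h | h
  · have h2 : Real.log p ^ 2 ≤ Fintype.card ι * -Real.log p := by nlinarith
    have h3 := mul_le_mul_of_nonneg_left h2
      (by positivity : (0 : ℝ) ≤ 32 * Fintype.card ι * M ^ 2)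
    have h4 : 0 ≤ b ^ 2 * -Real.log p := by positivity
    nlinarith
  · have h2 : ∑ i, ((Measure.pi fun _ : Fin n => P.withDensity fun x =>
        ENNReal.ofReal (L i x)).real A / p - 1) ^ 2 ≤ ∑ _i : ι, b ^ 2 := by
      refine Finset.sum_le_sum fun i _ => ?_
      have := hL.abs_likelihood_sub_one_le hA (fun x hx => hb x hx i) hpos
      exact sq_le_sq' (abs_le.1 this).1 (abs_le.1 this).2
    rw [Finset.sum_const, Finset.card_univ, nsmul_eq_mul] at h2
    have h3 := mul_le_mul_of_nonneg_left h (sq_nonneg b)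
    have h4 : 0 ≤ (128 * s ^ 2 * n + 32 * (Fintype.card ι : ℝ) ^ 2 * M ^ 2) * -Real.log p := by
      positivity
    nlinarith

end IsBesselFamily

/-! ### Tails of the likelihood ratios, and the bound for Bessel families -/

/-- Markov's inequality for positive and negative powers. -/
theorem measureReal_abs_sub_one_gt_le {Ω : Type*} [MeasurableSpace Ω] {Q : Measure Ω}
    [IsProbabilityMeasure Q] {F : Ω → ℝ} (hF : Measurable F) (hpos : ∀ x, 0 < F x) {l c b : ℝ}
    (hl : 0 < l) (hc : 0 ≤ c) (hb0 : 0 ≤ b) (hb : b ≤ 1 / 2)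
    (h1 : ∫⁻ x, ENNReal.ofReal (F x ^ l) ∂Q ≤ ENNReal.ofReal c)
    (h2 : ∫⁻ x, ENNReal.ofReal (F x ^ (-l)) ∂Q ≤ ENNReal.ofReal c) :
    Q.real {x | b < |F x - 1|} ≤ 2 * c * Real.exp (-(l * b / 2)) := by
  have markov : ∀ r : ℝ, ∫⁻ x, ENNReal.ofReal (F x ^ r) ∂Q ≤ ENNReal.ofReal c →
      Q.real {x | Real.exp (l * b / 2) ≤ F x ^ r} ≤ c * Real.exp (-(l * b / 2)) := by
    intro r hr
    have h := meas_ge_le_lintegral_div (μ := Q) (f := fun x => ENNReal.ofReal (F x ^ r))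
      (hF.pow_const r).ennreal_ofReal.aemeasurable
      (ε := ENNReal.ofReal (Real.exp (l * b / 2))) (by simp [Real.exp_pos]) ENNReal.ofReal_ne_top
    have hset : {x | ENNReal.ofReal (Real.exp (l * b / 2)) ≤ ENNReal.ofReal (F x ^ r)} =
        {x | Real.exp (l * b / 2) ≤ F x ^ r} := by
      ext x
      exact ENNReal.ofReal_le_ofReal_iff (Real.rpow_nonneg (hpos x).le r)
    rw [hset] at h
    have h3 := h.trans (ENNReal.div_le_div_right hr _)
    rw [← ENNReal.ofReal_div_of_pos (Real.exp_pos _)] at h3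
    have h4 := ENNReal.toReal_le_of_le_ofReal (by positivity) h3
    rw [Real.exp_neg, ← div_eq_mul_inv]
    exact h4
  -- This uses `b / 2 ≤ log (1 + b)` on the upper side and `log (1 - b) ≤ -b` on the lower one.
  have hsub : {x | b < |F x - 1|} ⊆ {x | Real.exp (l * b / 2) ≤ F x ^ l} ∪
      {x | Real.exp (l * b / 2) ≤ F x ^ (-l)} := by
    intro x hx
    have hx' : b < |F x - 1| := hx
    rcases lt_abs.1 hx' with h | h
    · left
      have h3 : b / 2 ≤ Real.log (F x) := by
        refine le_trans ?_ (Real.one_sub_inv_le_log_of_pos (hpos x))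
        have : (F x)⁻¹ ≤ (1 + b)⁻¹ := inv_anti₀ (by linarith) (by linarith)
        have h4 : (1 + b)⁻¹ ≤ 1 - b / 2 := by
          rw [inv_le_iff_one_le_mul₀ (by linarith)]; nlinarith
        linarith
      show Real.exp (l * b / 2) ≤ F x ^ l
      rw [Real.rpow_def_of_pos (hpos x)]
      apply Real.exp_le_exp.2
      nlinarith
    · right
      have h3 : Real.log (F x) ≤ -b := by
        have := Real.log_le_sub_one_of_pos (hpos x); linarith
      show Real.exp (l * b / 2) ≤ F x ^ (-l)
      rw [Real.rpow_def_of_pos (hpos x)]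
      apply Real.exp_le_exp.2
      nlinarith [mul_nonneg hl.le hb0]
  calc Q.real {x | b < |F x - 1|} ≤ _ := measureReal_mono hsub
    _ ≤ _ := measureReal_union_le _ _
    _ ≤ _ := by linarith [markov l h1, markov (-l) h2]

/-- Samples for which all one-point likelihood ratios are within `M` of `1` and those of all
suffixes are within `b` of `1`. -/
def likelihoodBall {S ι : Type*} (L : ι → S → ℝ) (M b : ℝ) (n : ℕ) : Set (Fin n → S) :=
  {x | ∀ i, (∀ t, |L i (x t) - 1| ≤ M) ∧ ∀ k : Fin n, |suffixLik L i k x - 1| ≤ b}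

theorem isTame_of_mem_likelihoodBall {S ι : Type*} {L : ι → S → ℝ} {M b : ℝ} {n : ℕ}
    {x : Fin n → S} (hb : b ≤ 1) (hx : x ∈ likelihoodBall L M b n) : IsTame L M x := by
  refine fun i => ⟨(hx i).1, fun k => ?_⟩
  rcases lt_or_ge k n with hk | hk
  · have := (abs_le.1 ((hx i).2 ⟨k, hk⟩)).2
    simp only at this
    linarith
  · have : suffixLik L i k x = 1 :=
      Finset.prod_eq_one fun t _ => if_neg (by have := t.2; omega)
    rw [this]; norm_num

theorem abs_prod_sub_one_le_of_mem_likelihoodBall {S ι : Type*} {L : ι → S → ℝ} {M b : ℝ} {n : ℕ}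
    (hn : 1 ≤ n) {x : Fin n → S} (hx : x ∈ likelihoodBall L M b n) (i : ι) :
    |∏ t, L i (x t) - 1| ≤ b := by
  rw [← suffixLik_zero]; exact (hx i).2 ⟨0, hn⟩

theorem measurable_suffixLik {S ι : Type*} [MeasurableSpace S] {L : ι → S → ℝ} {i : ι}
    (hL : Measurable (L i)) (n k : ℕ) :
    Measurable fun x : Fin n → S => suffixLik L i k x := by
  refine Finset.measurable_prod _ fun t _ => ?_
  split_ifs
  · exact hL.comp (measurable_pi_apply t)
  · exact measurable_const

theorem measurableSet_likelihoodBall {S ι : Type*} [MeasurableSpace S] [Finite ι] {L : ι → S → ℝ}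
    (hL : ∀ i, Measurable (L i)) (M b : ℝ) (n : ℕ) : MeasurableSet (likelihoodBall L M b n) := by
  have : likelihoodBall L M b n = ⋂ i, ((⋂ t, {x | |L i (x t) - 1| ≤ M}) ∩
      ⋂ k : Fin n, {x | |suffixLik L i k x - 1| ≤ b}) := by
    ext x; simp [likelihoodBall]
  rw [this]
  refine MeasurableSet.iInter fun i => (MeasurableSet.iInter fun t => ?_).inter
    (MeasurableSet.iInter fun k => ?_)
  · have : Measurable fun x : Fin n → S => L i (x t) := (hL i).comp (measurable_pi_apply t)
    exact measurableSet_le (by fun_prop) measurable_const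
  · have := measurable_suffixLik (hL i) n k
    exact measurableSet_le (by fun_prop) measurable_const

/-- The moment factorizes over the samples; those before `k` contribute `1`, which is at most `exp
c`. -/
theorem lintegral_suffixLik_rpow_le {S ι : Type*} [MeasurableSpace S] {P : Measure S}
    [IsProbabilityMeasure P] {L : ι → S → ℝ} (hmeas : ∀ i, Measurable (L i))
    (hpos : ∀ i x, 0 < L i x) {i : ι} {l c : ℝ} (hc : 0 ≤ c)
    (h : ∫⁻ x, ENNReal.ofReal (L i x ^ l) ∂P ≤ ENNReal.ofReal (Real.exp c)) (n k : ℕ) :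
    ∫⁻ x : Fin n → S, ENNReal.ofReal (suffixLik L i k x ^ l) ∂(Measure.pi fun _ => P) ≤
      ENNReal.ofReal (Real.exp (n * c)) := by
  have h1 : ∀ x : Fin n → S, ENNReal.ofReal (suffixLik L i k x ^ l) =
      ∏ t : Fin n, (if k ≤ (t : ℕ) then fun z => ENNReal.ofReal (L i z ^ l) else fun _ => 1)
        (x t) := by
    intro x
    rw [suffixLik, ← Real.finsetProd_rpow _ _
      (fun t _ => by split_ifs; exacts [(hpos _ _).le, zero_le_one]),
      ENNReal.ofReal_prod_of_nonneg
        (fun t _ => Real.rpow_nonneg (by split_ifs; exacts [(hpos _ _).le, zero_le_one]) _)]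
    refine Finset.prod_congr rfl fun t _ => ?_
    split_ifs <;> simp
  simp_rw [h1]
  rw [lintegral_pi_prod_eq P (f := fun t : Fin n =>
    if k ≤ (t : ℕ) then fun z => ENNReal.ofReal (L i z ^ l) else fun _ => 1)]
  · calc _ ≤ ∏ _t : Fin n, ENNReal.ofReal (Real.exp c) := by
          refine Finset.prod_le_prod' fun t _ => ?_
          split_ifs
          · exact h
          · simp [hc]
      _ = _ := by
          rw [Finset.prod_const, Finset.card_univ, Fintype.card_fin,
            ← ENNReal.ofReal_pow (Real.exp_pos _).le, ← Real.exp_nat_mul]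
  · intro t
    split_ifs
    · exact ((hmeas i).pow_const l).ennreal_ofReal
    · exact measurable_const

section Tails

variable {S ι : Type*} [MeasurableSpace S] [Fintype ι] {P : Measure S} [IsProbabilityMeasure P]
  {L : ι → S → ℝ} {s σ : ℝ}

/-- The likelihood ratios are close to `1` except for an exponentially small set of samples. -/
theorem measureReal_compl_likelihoodBall_le (hmeas : ∀ i, Measurable (L i))
    (hpos : ∀ i x, 0 < L i x) (hσ : 0 < σ)
    (hmgf : ∀ i (l : ℝ), |l - 1| * σ ≤ 1 / 2 →
      ∫⁻ x, ENNReal.ofReal (L i x ^ l) ∂P ≤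
        ENNReal.ofReal (Real.exp (2 * ((|l| + 1) * σ) ^ 2)))
    {n : ℕ} (hn : 1 ≤ n) (hσn : σ * √n ≤ 1 / 4) {τ : ℝ} (hτ : 0 ≤ τ) (hb : σ * √n * τ ≤ 1 / 2) :
    (Measure.pi fun _ : Fin n => P).real (likelihoodBall L (σ * τ) (σ * √n * τ) n)ᶜ ≤
      8 * Fintype.card ι * n * Real.exp (-(τ / 8)) := by
  have hn1 : (1 : ℝ) ≤ √n := Real.one_le_sqrt.2 (by exact_mod_cast hn)
  have hn0 : (0 : ℝ) ≤ n := Nat.cast_nonneg n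
  have hσ4 : σ ≤ 1 / 4 := by nlinarith
  -- powers up to `1 / (4 σ)` over `ν` copies
  have hpow : ∀ (ν : ℝ), 1 ≤ ν → σ * ν ≤ 1 / 4 → ∀ i (l : ℝ), |l| = 1 / (4 * (σ * ν)) →
      ∫⁻ x, ENNReal.ofReal (L i x ^ l) ∂P ≤ ENNReal.ofReal (Real.exp (1 / (2 * ν ^ 2))) := by
    intro ν hν hσν i l hl
    have hν0 : 0 < ν := by linarith
    have e1 : |l| * σ = 1 / (4 * ν) := by rw [hl]; field_simp
    have e2 : 1 / (4 * ν) ≤ 1 / 4 := by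
      rw [div_le_div_iff₀ (by positivity) (by norm_num)]; linarith
    have e3 : |l - 1| * σ ≤ (|l| + 1) * σ :=
      mul_le_mul_of_nonneg_right (by simpa using abs_sub l 1) hσ.le
    have e4 : σ ≤ 1 / (4 * ν) := by rw [le_div_iff₀ (by positivity)]; nlinarith
    refine (hmgf i l (by nlinarith)).trans (ENNReal.ofReal_le_ofReal (Real.exp_le_exp.2 ?_))
    have e5 : (|l| + 1) * σ ≤ 1 / (2 * ν) := by
      have : 1 / (2 * ν) = 1 / (4 * ν) + 1 / (4 * ν) := by field_simp; ring
      rw [this]; linarith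
    have e6 : ((|l| + 1) * σ) ^ 2 ≤ (1 / (2 * ν)) ^ 2 := pow_le_pow_left₀ (by positivity) e5 2
    calc 2 * ((|l| + 1) * σ) ^ 2 ≤ 2 * (1 / (2 * ν)) ^ 2 := by linarith
      _ = 1 / (2 * ν ^ 2) := by field_simp
  have hexp : Real.exp (1 / 2) ≤ 2 := by
    have h1 : Real.exp (1 / 2) ^ 2 = Real.exp 1 := by rw [← Real.exp_nat_mul]; norm_num
    nlinarith [Real.exp_one_lt_d9, Real.exp_pos (1 / 2)]
  have hE : 0 < Real.exp (-(τ / 8)) := Real.exp_pos _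
  have hsingle : ∀ i (t : Fin n), (Measure.pi fun _ : Fin n => P).real
      {x | σ * τ < |L i (x t) - 1|} ≤ 4 * Real.exp (-(τ / 8)) := by
    intro i t
    have h0 : (Measure.pi fun _ : Fin n => P).real {x | σ * τ < |L i (x t) - 1|} =
        P.real {z | σ * τ < |L i z - 1|} := by
      have hm := measurePreserving_eval (fun _ : Fin n => P) t
      have := hm.measureReal_preimage (s := {z | σ * τ < |L i z - 1|})
        (measurableSet_lt measurable_const
          ((hmeas i).sub_const 1).norm).nullMeasurableSet
      exact this
    have hp := hpow 1 le_rfl (by linarith) i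
    have hb1 : σ * τ ≤ 1 / 2 := by
      have : σ * τ ≤ σ * τ * √n := le_mul_of_one_le_right (by positivity) hn1
      linarith
    have h1 := measureReal_abs_sub_one_gt_le (Q := P) (hmeas i) (hpos i) (l := 1 / (4 * (σ * 1)))
      (c := Real.exp (1 / (2 * 1 ^ 2))) (b := σ * τ) (by positivity) (Real.exp_pos _).le
      (by positivity) hb1 (hp _ (abs_of_pos (by positivity)))
      (hp _ (by rw [abs_neg]; exact abs_of_pos (by positivity)))
    have e : -(1 / (4 * (σ * 1)) * (σ * τ) / 2) = -(τ / 8) := by field_simp; ring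
    rw [e] at h1
    norm_num at h1 hexp
    rw [h0]
    nlinarith
  have hsuffix : ∀ i (k : Fin n), (Measure.pi fun _ : Fin n => P).real
      {x | σ * √n * τ < |suffixLik L i k x - 1|} ≤ 4 * Real.exp (-(τ / 8)) := by
    intro i k
    -- For powers of order `1 / (σ * √n)` each sample contributes at most `exp (1 / (2 * n))`, so
    -- the whole moment stays bounded.
    have hp : ∀ l : ℝ, |l| = 1 / (4 * (σ * √n)) →
        ∫⁻ x : Fin n → S, ENNReal.ofReal (suffixLik L i k x ^ l) ∂(Measure.pi fun _ => P) ≤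
        ENNReal.ofReal (Real.exp (1 / 2)) := by
      intro l hl
      have h1 := lintegral_suffixLik_rpow_le hmeas hpos (by positivity)
        (hpow _ hn1 hσn i l hl) n k
      have e : (n : ℝ) * (1 / (2 * √n ^ 2)) = 1 / 2 := by
        rw [Real.sq_sqrt hn0]
        have : (n : ℝ) ≠ 0 := by positivity
        field_simp
      rwa [e] at h1
    have hspos : ∀ x : Fin n → S, 0 < suffixLik L i k x := fun x =>
      Finset.prod_pos fun t _ => by split_ifs; exacts [hpos _ _, one_pos]
    have h1 := measureReal_abs_sub_one_gt_le (Q := Measure.pi fun _ : Fin n => P)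
      (measurable_suffixLik (hmeas i) n k) hspos (l := 1 / (4 * (σ * √n)))
      (c := Real.exp (1 / 2)) (b := σ * √n * τ) (by positivity) (Real.exp_pos _).le
      (by positivity) hb (hp _ (abs_of_pos (by positivity)))
      (hp _ (by rw [abs_neg]; exact abs_of_pos (by positivity)))
    have e : -(1 / (4 * (σ * √n)) * (σ * √n * τ) / 2) = -(τ / 8) := by field_simp; ring
    rw [e] at h1
    nlinarith
  have hsub : (likelihoodBall L (σ * τ) (σ * √n * τ) n)ᶜ ⊆
      ⋃ i, ((⋃ t, {x | σ * τ < |L i (x t) - 1|}) ∪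
        ⋃ k : Fin n, {x | σ * √n * τ < |suffixLik L i k x - 1|}) := by
    intro x hx
    simp only [likelihoodBall, Set.mem_compl_iff, Set.mem_ofPred_eq, not_forall, not_and_or,
      not_le] at hx
    obtain ⟨i, ⟨t, ht⟩ | ⟨k, hk⟩⟩ := hx
    · exact Set.mem_iUnion.2 ⟨i, Or.inl (Set.mem_iUnion.2 ⟨t, ht⟩)⟩
    · exact Set.mem_iUnion.2 ⟨i, Or.inr (Set.mem_iUnion.2 ⟨k, hk⟩)⟩
  calc _ ≤ _ := measureReal_mono hsub
    _ ≤ ∑ i, (Measure.pi fun _ : Fin n => P).real ((⋃ t, {x | σ * τ < |L i (x t) - 1|}) ∪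
        ⋃ k : Fin n, {x | σ * √n * τ < |suffixLik L i k x - 1|}) := measureReal_iUnion_fintype_le _
    -- For each index there are `n` one-point events and `n` suffix events.
    _ ≤ ∑ _i : ι, (n * (4 * Real.exp (-(τ / 8))) + n * (4 * Real.exp (-(τ / 8)))) := by
        refine Finset.sum_le_sum fun i _ => (measureReal_union_le _ _).trans (add_le_add ?_ ?_)
        · refine (measureReal_iUnion_fintype_le _).trans
            ((Finset.sum_le_sum fun t _ => hsingle i t).trans (by simp))
        · refine (measureReal_iUnion_fintype_le _).trans
            ((Finset.sum_le_sum fun k _ => hsuffix i k).trans (by simp))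
    _ = _ := by rw [Finset.sum_const, Finset.card_univ, nsmul_eq_mul]; ring

namespace IsBesselFamily

theorem integral_sq_le (hL : IsBesselFamily P L s) (i : ι) :
    ∫ x, L i x ^ 2 ∂P ≤ 1 + s ^ 2 := by
  classical
  have h := hL.bessel (Pi.single i 1)
  have h1 : ∀ x, ∑ j, (Pi.single i 1 : ι → ℝ) j * (L j x - 1) = L i x - 1 := by
    intro x; simp [Pi.single_apply]
  have h2 : ∑ j, (Pi.single i 1 : ι → ℝ) j ^ 2 = 1 := by simp [Pi.single_apply]
  simp_rw [h1, h2] at h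
  have h3 : ∀ x, (L i x - 1) ^ 2 = L i x ^ 2 - 2 * L i x + 1 := fun x => by ring
  simp_rw [h3] at h
  have hi1 : Integrable (fun x => L i x ^ 2) P := (hL.memLp i).integrable_sq
  have hi2 : Integrable (fun x => 2 * L i x) P := (hL.integrable i).const_mul 2
  have hi3 : Integrable (fun x => L i x ^ 2 - 2 * L i x) P := hi1.sub hi2
  rw [integral_add hi3 (integrable_const _), integral_sub hi1 hi2,
    integral_const_mul, hL.integral_eq_one] at h
  simp at h
  linarith

/-- Transfer of small probabilities from the null law to the laws of the family. -/
theorem pi_real_le_sqrt (hL : IsBesselFamily P L s) (i : ι) {n : ℕ} (hsn : n * s ^ 2 ≤ 1)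
    {A : Set (Fin n → S)} (hA : MeasurableSet A) {δ : ℝ} (hδ : 0 < δ)
    (hAδ : (Measure.pi fun _ : Fin n => P).real A ≤ δ) :
    (Measure.pi fun _ : Fin n => P.withDensity fun x => ENNReal.ofReal (L i x)).real A ≤
      2 * √δ := by
  rw [hL.pi_real_eq_setIntegral i hA]
  have hsq : Integrable (fun x : Fin n → S => ∏ t, L i (x t) ^ 2) (Measure.pi fun _ => P) :=
    Integrable.fintype_prod fun _ => (hL.memLp i).integrable_sq
  have hint : ∫ x : Fin n → S, ∏ t, L i (x t) ^ 2 ∂(Measure.pi fun _ => P) ≤ 3 := by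
    rw [integral_fintype_prod_eq_prod (fun (_ : Fin n) z => L i z ^ 2)]
    rw [Finset.prod_const, Finset.card_univ, Fintype.card_fin]
    calc _ ≤ (1 + s ^ 2) ^ n :=
          pow_le_pow_left₀ (integral_nonneg fun x => sq_nonneg _) (hL.integral_sq_le i) n
      _ ≤ Real.exp (s ^ 2) ^ n :=
          pow_le_pow_left₀ (by positivity) (by linarith [Real.add_one_le_exp (s ^ 2)]) n
      _ = Real.exp (n * s ^ 2) := by rw [← Real.exp_nat_mul]
      _ ≤ Real.exp 1 := Real.exp_le_exp.2 hsn
      _ ≤ 3 := by linarith [Real.exp_one_lt_d9]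
  set w := √δ with hw
  have hw0 : 0 < w := Real.sqrt_pos.2 hδ
  have hw2 : w ^ 2 = δ := Real.sq_sqrt hδ.le
  -- A weighted form of Cauchy–Schwarz: with `w = √δ`, the second moment contributes at most `3 * w
  -- / 2` and the set itself at most `w / 2`.
  have hpt : ∀ x : Fin n → S, ∏ t, L i (x t) ≤ w / 2 * ∏ t, L i (x t) ^ 2 + (2 * w)⁻¹ := by
    intro x
    rw [Finset.prod_pow]
    have : w / 2 * (∏ t, L i (x t)) ^ 2 + (2 * w)⁻¹ - ∏ t, L i (x t) =
        (2 * w)⁻¹ * (w * (∏ t, L i (x t)) - 1) ^ 2 := by field_simp; ring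
    have : 0 ≤ (2 * w)⁻¹ * (w * (∏ t, L i (x t)) - 1) ^ 2 := by positivity
    linarith
  have h1 : ∫ x in A, ∏ t, L i (x t) ∂(Measure.pi fun _ => P) ≤
      ∫ x in A, (w / 2 * ∏ t, L i (x t) ^ 2 + (2 * w)⁻¹) ∂(Measure.pi fun _ => P) :=
    integral_mono (hL.integrable_prod i n).integrableOn
      ((hsq.const_mul _).integrableOn.add (integrable_const _)) hpt
  rw [integral_add (hsq.const_mul _).integrableOn (integrable_const _), integral_const_mul,
    setIntegral_const, smul_eq_mul] at h1
  have h2 : ∫ x in A, ∏ t, L i (x t) ^ 2 ∂(Measure.pi fun _ => P) ≤ 3 :=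
    (setIntegral_le_integral hsq (Filter.Eventually.of_forall fun x =>
      Finset.prod_nonneg fun t _ => sq_nonneg _)).trans hint
  have h3 : (Measure.pi fun _ : Fin n => P).real A * (2 * w)⁻¹ ≤ w / 2 := by
    calc _ ≤ w ^ 2 * (2 * w)⁻¹ := by
          rw [hw2]; exact mul_le_mul_of_nonneg_right hAδ (by positivity)
      _ = w / 2 := by field_simp
  have h4 := mul_le_mul_of_nonneg_left h2 (by positivity : 0 ≤ w / 2)
  linarith

/-- Deterministic protocols that separate the laws of the family from the null law are long. -/
theorem card_le_of_separates [Nonempty ι] (hL : IsBesselFamily P L s) (hs : 0 < s)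
    (hpos : ∀ i x, 0 < L i x)
    (hσ : 0 < σ)
    (hmgf : ∀ i (l : ℝ), |l - 1| * σ ≤ 1 / 2 →
      ∫⁻ x, ENNReal.ofReal (L i x ^ l) ∂P ≤
        ENNReal.ofReal (Real.exp (2 * ((|l| + 1) * σ) ^ 2)))
    {n m : ℕ} (hn : 1 ≤ n) (hσn : σ * √n ≤ 1 / 4) (hsn : n * s ^ 2 ≤ 1) {τ : ℝ} (hτ : 0 ≤ τ)
    (hb : σ * √n * τ ≤ 1 / 2) {δ : ℝ} (hδ1 : δ ≤ 1)
    (hδ : 2 * √(8 * Fintype.card ι * n * Real.exp (-(τ / 8))) ≤ δ)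
    (π : DetProtocol m (Fin n → S) ι) (B : ℕ) (hB : ∀ x, π.bitsSent x ≤ B)
    (hsep : (Fintype.card ι : ℝ) / 2 ≤ ∑ i,
      ((Measure.pi fun _ : Fin m => Measure.pi fun _ : Fin n =>
          P.withDensity fun x => ENNReal.ofReal (L i x)).real {x | π.output x = i} -
        (Measure.pi fun _ : Fin m => Measure.pi fun _ : Fin n => P).real
          {x | π.output x = i})) :
    3 / 8 * (Fintype.card ι : ℝ) ≤ 17 * Fintype.card ι * (m * δ) +
      16 * (128 * s ^ 2 * n + 32 * Fintype.card ι ^ 2 * (σ * τ) ^ 2 + (σ * √n * τ) ^ 2) *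
        (B + 1) := by
  have hprob := hL.isProbabilityMeasure_withDensity
  set δ₀ := 8 * Fintype.card ι * n * Real.exp (-(τ / 8)) with hδ₀
  have hδ₀pos : 0 < δ₀ := by
    have : (0 : ℝ) < n := by exact_mod_cast hn
    have : (0 : ℝ) < Fintype.card ι := by exact_mod_cast Fintype.card_pos
    positivity
  -- Since `2 * √δ₀ ≤ δ ≤ 1`, also `δ₀ ≤ √δ₀`; so `δ` serves for the null law too.
  have hsqrt : δ₀ ≤ δ := by
    have h1 := Real.sq_sqrt hδ₀pos.le
    have h2 := Real.sqrt_nonneg δ₀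
    nlinarith
  have hGm := measurableSet_likelihoodBall hL.measurable (σ * τ) (σ * √n * τ) n
  have hG0 := measureReal_compl_likelihoodBall_le hL.measurable hpos hσ hmgf hn hσn hτ hb
  refine _root_.card_le_of_separates π B hB (Measure.pi fun _ : Fin n => P)
    (fun i => Measure.pi fun _ : Fin n => P.withDensity fun x => ENNReal.ofReal (L i x))
    (fun i => by rw [hL.pi_withDensity]; exact withDensity_absolutelyContinuous _ _)
    hGm ((Real.sqrt_nonneg δ₀).trans (by linarith [Real.sqrt_nonneg δ₀])) hδ1 (by positivity)
    ?_ ?_ ?_ hsep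
  · have := probReal_compl_eq_one_sub (μ := Measure.pi fun _ : Fin n => P) hGm
    linarith
  · intro i
    have h1 := hL.pi_real_le_sqrt i hsn hGm.compl hδ₀pos hG0
    have := probReal_compl_eq_one_sub (μ := Measure.pi fun _ : Fin n =>
      P.withDensity fun x => ENNReal.ofReal (L i x)) hGm
    linarith
  · intro A hA hAG hApos
    exact ⟨fun i => (hL.abs_likelihood_sub_one_le hA (fun x hx =>
        abs_prod_sub_one_le_of_mem_likelihoodBall hn (hAG hx) i) hApos).trans hb,
      hL.sum_likelihood_sub_one_sq_le_mul_neg_log hs (by positivity) hn hA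
        (fun x hx => isTame_of_mem_likelihoodBall (by linarith) (hAG hx))
        (fun x hx => abs_prod_sub_one_le_of_mem_likelihoodBall hn (hAG hx)) hApos⟩

end IsBesselFamily

end Tails

/-! ### The correlated Gaussian pair and the moments of its density -/

/-- The density of a pair of standard Gaussians with correlation `σ` relative to an independent
pair. -/
noncomputable def corrDensity (σ x y : ℝ) : ℝ :=
  (√(1 - σ ^ 2))⁻¹ * Real.exp ((2 * σ * x * y - σ ^ 2 * (x ^ 2 + y ^ 2)) / (2 * (1 - σ ^ 2)))

theorem corrDensity_comm (σ x y : ℝ) : corrDensity σ x y = corrDensity σ y x := by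
  unfold corrDensity; ring_nf

theorem measurable_corrDensity (σ : ℝ) : Measurable fun p : ℝ × ℝ => corrDensity σ p.1 p.2 := by
  unfold corrDensity; fun_prop

theorem one_sub_sq_pos {σ : ℝ} (h0 : 0 < σ) (h1 : σ < 1) : 0 < 1 - σ ^ 2 := by nlinarith

theorem corrDensity_pos {σ : ℝ} (h0 : 0 < σ) (h1 : σ < 1) (x y : ℝ) : 0 < corrDensity σ x y := by
  have := one_sub_sq_pos h0 h1
  unfold corrDensity; positivity

/-- The conditional law of one coordinate given the other, relative to the standard Gaussian. -/
theorem gaussianReal_eq_withDensity_corrDensity {σ : ℝ} (h0 : 0 < σ) (h1 : σ < 1) (x : ℝ) :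
    gaussianReal (σ * x) (1 - σ ^ 2).toNNReal =
      (gaussianReal 0 1).withDensity fun y => ENNReal.ofReal (corrDensity σ x y) := by
  have hv := one_sub_sq_pos h0 h1
  have hm : Measurable fun y => ENNReal.ofReal (corrDensity σ x y) :=
    ((measurable_corrDensity σ).comp (by fun_prop : Measurable fun y : ℝ => (x, y))).ennreal_ofReal
  rw [gaussianReal_of_var_ne_zero _ (by simpa using hv), gaussianReal_of_var_ne_zero _ one_ne_zero,
    ← withDensity_mul _ (measurable_gaussianPDF _ _) hm]
  congr 1
  ext y
  rw [Pi.mul_apply, gaussianPDF_def, gaussianPDF_def,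
    ← ENNReal.ofReal_mul (gaussianPDFReal_nonneg _ _ _)]
  refine congrArg ENNReal.ofReal ?_
  simp only [gaussianPDFReal, corrDensity, Real.coe_toNNReal _ hv.le, NNReal.coe_one, mul_one]
  rw [Real.sqrt_mul (by positivity : 0 ≤ 2 * Real.pi) (1 - σ ^ 2), mul_inv]
  have e : Real.exp (-(y - σ * x) ^ 2 / (2 * (1 - σ ^ 2))) = Real.exp (-(y - 0) ^ 2 / 2) *
      Real.exp ((2 * σ * x * y - σ ^ 2 * (x ^ 2 + y ^ 2)) / (2 * (1 - σ ^ 2))) := by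
    rw [← Real.exp_add]
    congr 1
    field_simp
    ring
  rw [e]
  ring

theorem lintegral_corrDensity_eq_one {σ : ℝ} (h0 : 0 < σ) (h1 : σ < 1) (x : ℝ) :
    ∫⁻ y, ENNReal.ofReal (corrDensity σ x y) ∂(gaussianReal 0 1) = 1 := by
  have h := congrArg (fun μ => μ Set.univ) (gaussianReal_eq_withDensity_corrDensity h0 h1 x)
  simp only [withDensity_apply _ MeasurableSet.univ, Measure.restrict_univ, measure_univ] at h
  exact h.symm

theorem lintegral_exp_quadratic_gaussianReal (a : ℝ) {b : ℝ} (hb : 0 < 1 + b) :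
    ∫⁻ y, ENNReal.ofReal (Real.exp (a * y - b * y ^ 2 / 2)) ∂(gaussianReal 0 1) =
      ENNReal.ofReal ((√(1 + b))⁻¹ * Real.exp (a ^ 2 / (2 * (1 + b)))) := by
  rw [gaussianReal_of_var_ne_zero _ one_ne_zero,
    lintegral_withDensity_eq_lintegral_mul _ (measurable_gaussianPDF _ _) (by fun_prop)]
  have hv : (0 : ℝ) < (1 + b)⁻¹ := by positivity
  have h : ∀ y, (gaussianPDF 0 1 * fun y => ENNReal.ofReal (Real.exp (a * y - b * y ^ 2 / 2))) y =
      ENNReal.ofReal ((√(1 + b))⁻¹ * Real.exp (a ^ 2 / (2 * (1 + b)))) *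
        ENNReal.ofReal (gaussianPDFReal (a / (1 + b)) ((1 + b)⁻¹).toNNReal y) := by
    intro y
    rw [Pi.mul_apply, gaussianPDF_def, ← ENNReal.ofReal_mul (gaussianPDFReal_nonneg _ _ _),
      ← ENNReal.ofReal_mul (by positivity)]
    congr 1
    simp only [gaussianPDFReal, Real.coe_toNNReal _ hv.le]
    rw [
      Real.sqrt_mul (by positivity : 0 ≤ 2 * Real.pi) (1 + b)⁻¹, Real.sqrt_inv, NNReal.coe_one,
      mul_one, mul_one, mul_inv, inv_inv]
    have hs : (√(1 + b))⁻¹ * √(1 + b) = 1 := inv_mul_cancel₀ (Real.sqrt_pos.2 hb).ne'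
    have e : Real.exp (-(y - 0) ^ 2 / 2) * Real.exp (a * y - b * y ^ 2 / 2) =
        Real.exp (a ^ 2 / (2 * (1 + b))) *
          Real.exp (-(y - a / (1 + b)) ^ 2 / (2 * (1 + b)⁻¹)) := by
      rw [← Real.exp_add, ← Real.exp_add]
      congr 1
      field_simp
      ring
    calc _ = (√(2 * Real.pi))⁻¹ *
          (Real.exp (-(y - 0) ^ 2 / 2) * Real.exp (a * y - b * y ^ 2 / 2)) := by ring
      _ = ((√(1 + b))⁻¹ * √(1 + b)) * (√(2 * Real.pi))⁻¹ * (Real.exp (a ^ 2 / (2 * (1 + b))) *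
          Real.exp (-(y - a / (1 + b)) ^ 2 / (2 * (1 + b)⁻¹))) := by rw [e, hs, one_mul]
      _ = _ := by ring
  simp_rw [h]
  rw [lintegral_const_mul' _ _ ENNReal.ofReal_ne_top,
    lintegral_gaussianPDFReal_eq_one _ (by simpa using hb), mul_one]

/-- A Gaussian integral: the quadratic form in the exponent has determinant `(1 - (l - 1) ^ 2 * σ ^
2) / (1 - σ ^ 2)`, and `hl` keeps it away from `0`. -/
theorem lintegral_lintegral_corrDensity_rpow {σ : ℝ} (h0 : 0 < σ) (h1 : σ ≤ 1 / 4) {l : ℝ}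
    (hl : |l - 1| * σ ≤ 1 / 2) :
    ∫⁻ x, ∫⁻ y, ENNReal.ofReal (corrDensity σ x y ^ l) ∂(gaussianReal 0 1) ∂(gaussianReal 0 1) =
      ENNReal.ofReal (√(1 - σ ^ 2) ^ (1 - l) * (√(1 - (l - 1) ^ 2 * σ ^ 2))⁻¹) := by
  have hv : 0 < 1 - σ ^ 2 := one_sub_sq_pos h0 (by linarith)
  have hv' : 15 / 16 ≤ 1 - σ ^ 2 := by nlinarith
  have hw : (l - 1) ^ 2 * σ ^ 2 ≤ 1 / 4 := by
    have := pow_le_pow_left₀ (by positivity) hl 2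
    rw [mul_pow, sq_abs] at this
    linarith
  have hls : |l * σ| ≤ 3 / 4 := by
    have h2 : l * σ = (l - 1) * σ + σ := by ring
    rw [h2]
    refine (abs_add_le _ _).trans ?_
    rw [abs_mul, abs_of_pos h0]
    linarith
  obtain ⟨h3, h4⟩ := abs_le.1 hls
  set v := 1 - σ ^ 2 with hvdef
  obtain ⟨α, hα⟩ : ∃ α, α = l * σ / v := ⟨_, rfl⟩
  obtain ⟨β, hβ⟩ : ∃ β, β = σ * α := ⟨_, rfl⟩
  have hα1 : |α| ≤ 4 / 5 := by
    rw [hα, abs_div, abs_of_pos hv, div_le_iff₀ hv]; linarith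
  obtain ⟨hα2, hα3⟩ := abs_le.1 hα1
  have hβ1 : 0 < 1 + β := by rw [hβ]; nlinarith
  have hdet : (1 + β) ^ 2 - α ^ 2 = (1 - (l - 1) ^ 2 * σ ^ 2) / v := by
    rw [hβ, hα]; field_simp; rw [hvdef]; ring
  have hdet0 : 0 < (1 + β) ^ 2 - α ^ 2 := by rw [hdet]; apply div_pos <;> linarith
  obtain ⟨b, hb⟩ : ∃ b, b = β - α ^ 2 / (1 + β) := ⟨_, rfl⟩
  have hb1 : (1 + β) * (1 + b) = (1 + β) ^ 2 - α ^ 2 := by rw [hb]; field_simp; ring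
  have hb0 : 0 < 1 + b := by
    by_contra h
    have : (1 + β) * (1 + b) ≤ 0 := mul_nonpos_of_nonneg_of_nonpos hβ1.le (not_lt.1 h)
    linarith
  set c := ((√v)⁻¹) ^ l with hc
  have hc0 : 0 ≤ c := by positivity
  have hpow : ∀ x y, ENNReal.ofReal (corrDensity σ x y ^ l) =
      ENNReal.ofReal (c * Real.exp (-β * x ^ 2 / 2)) *
        ENNReal.ofReal (Real.exp (α * x * y - β * y ^ 2 / 2)) := by
    intro x y
    rw [← ENNReal.ofReal_mul (by positivity), mul_assoc, ← Real.exp_add, corrDensity, ← hvdef,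
      Real.mul_rpow (by positivity) (Real.exp_pos _).le, ← Real.exp_mul]
    congr 3
    rw [hβ, hα]
    field_simp
    ring
  have hinner : ∀ x, ∫⁻ y, ENNReal.ofReal (corrDensity σ x y ^ l) ∂(gaussianReal 0 1) =
      ENNReal.ofReal (c * (√(1 + β))⁻¹) *
        ENNReal.ofReal (Real.exp (0 * x - b * x ^ 2 / 2)) := by
    intro x
    simp_rw [hpow]
    rw [lintegral_const_mul' _ _ ENNReal.ofReal_ne_top, lintegral_exp_quadratic_gaussianReal _ hβ1,
      ← ENNReal.ofReal_mul (by positivity), ← ENNReal.ofReal_mul (by positivity)]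
    congr 1
    have e : Real.exp (0 * x - b * x ^ 2 / 2) =
        Real.exp (-β * x ^ 2 / 2) * Real.exp ((α * x) ^ 2 / (2 * (1 + β))) := by
      rw [← Real.exp_add, hb]
      congr 1
      field_simp
      ring
    rw [e]; ring
  simp_rw [hinner]
  rw [lintegral_const_mul' _ _ ENNReal.ofReal_ne_top, lintegral_exp_quadratic_gaussianReal _ hb0,
    ← ENNReal.ofReal_mul (by positivity)]
  congr 1
  have e1 : (√(1 + β))⁻¹ * (√(1 + b))⁻¹ = √v * (√(1 - (l - 1) ^ 2 * σ ^ 2))⁻¹ := by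
    rw [← mul_inv, ← Real.sqrt_mul hβ1.le, hb1, hdet, Real.sqrt_div' _ hv.le,
      inv_div, div_eq_mul_inv]
  have e2 : c * √v = √v ^ (1 - l) := by
    rw [hc, Real.inv_rpow (Real.sqrt_nonneg _), Real.rpow_sub (Real.sqrt_pos.2 hv), Real.rpow_one]
    ring
  calc _ = c * ((√(1 + β))⁻¹ * (√(1 + b))⁻¹) := by simp; ring
    _ = _ := by rw [e1, ← mul_assoc, e2]

/-- Powers up to order `1 / σ` thus have bounded moments; this yields exponential tails on the scale
`σ`. -/
theorem lintegral_lintegral_corrDensity_rpow_le {σ : ℝ} (h0 : 0 < σ) (h1 : σ ≤ 1 / 4) {l : ℝ}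
    (hl : |l - 1| * σ ≤ 1 / 2) :
    ∫⁻ x, ∫⁻ y, ENNReal.ofReal (corrDensity σ x y ^ l) ∂(gaussianReal 0 1) ∂(gaussianReal 0 1) ≤
      ENNReal.ofReal (Real.exp (2 * ((|l| + 1) * σ) ^ 2)) := by
  rw [lintegral_lintegral_corrDensity_rpow h0 h1 hl]
  refine ENNReal.ofReal_le_ofReal ?_
  have hv : 0 < 1 - σ ^ 2 := one_sub_sq_pos h0 (by linarith)
  have hw : (l - 1) ^ 2 * σ ^ 2 ≤ 1 / 4 := by
    have := pow_le_pow_left₀ (by positivity) hl 2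
    rw [mul_pow, sq_abs] at this
    linarith
  have habs : |l - 1| ≤ |l| + 1 := by simpa using abs_sub l 1
  have hw0 : 0 < 1 - (l - 1) ^ 2 * σ ^ 2 := by linarith
  have hneglog : ∀ w : ℝ, 0 ≤ w → w ≤ 1 / 4 → -Real.log (1 - w) ≤ 2 * w := by
    intro w hw0 hw1
    have h := Real.one_sub_inv_le_log_of_pos (by linarith : 0 < 1 - w)
    have h2 : (1 - w)⁻¹ ≤ 1 + 2 * w := by
      rw [inv_le_iff_one_le_mul₀ (by linarith)]; nlinarith
    linarith
  have e1 : √(1 - σ ^ 2) ^ (1 - l) = Real.exp (Real.log (1 - σ ^ 2) / 2 * (1 - l)) := by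
    rw [Real.rpow_def_of_pos (Real.sqrt_pos.2 hv), Real.log_sqrt hv.le]
  have e2 : (√(1 - (l - 1) ^ 2 * σ ^ 2))⁻¹ =
      Real.exp (-Real.log (1 - (l - 1) ^ 2 * σ ^ 2) / 2) := by
    rw [← Real.exp_log (Real.sqrt_pos.2 hw0), ← Real.exp_neg, Real.log_sqrt hw0.le]
    congr 1; ring
  rw [e1, e2, ← Real.exp_add]
  apply Real.exp_le_exp.2
  have a1 := hneglog (σ ^ 2) (sq_nonneg _) (by nlinarith)
  have a2 := hneglog ((l - 1) ^ 2 * σ ^ 2) (by positivity) hw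
  have a3 : Real.log (1 - σ ^ 2) ≤ 0 := Real.log_nonpos hv.le (by nlinarith)
  have a4 : Real.log (1 - σ ^ 2) / 2 * (1 - l) ≤ σ ^ 2 * (|l| + 1) := by
    calc _ = -Real.log (1 - σ ^ 2) / 2 * (l - 1) := by ring
      _ ≤ -Real.log (1 - σ ^ 2) / 2 * (|l| + 1) :=
          mul_le_mul_of_nonneg_left ((le_abs_self _).trans habs) (by linarith)
      _ ≤ σ ^ 2 * (|l| + 1) := mul_le_mul_of_nonneg_right (by linarith) (by positivity)
  have a5 : (l - 1) ^ 2 ≤ (|l| + 1) ^ 2 := by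
    rw [← sq_abs (l - 1)]; exact pow_le_pow_left₀ (abs_nonneg _) habs 2
  have a6 : |l| + 1 ≤ (|l| + 1) ^ 2 := by nlinarith [abs_nonneg l]
  have a7 := mul_le_mul_of_nonneg_right a5 (sq_nonneg σ)
  have a8 := mul_le_mul_of_nonneg_left a6 (sq_nonneg σ)
  rw [mul_pow]
  linarith

/-! ### The density of `pairGaussian` -/

/-- Resampling one coordinate preserves a product measure. -/
theorem measurePreserving_update_pi {ι S : Type*} [Fintype ι] [DecidableEq ι] [MeasurableSpace S]
    (γ : Measure S) [IsProbabilityMeasure γ] (j : ι) :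
    MeasurePreserving (fun p : (ι → S) × S => Function.update p.1 j p.2)
      ((Measure.pi fun _ => γ).prod γ) (Measure.pi fun _ => γ) := by
  have hm : Measurable fun p : (ι → S) × S => Function.update p.1 j p.2 := by
    refine measurable_pi_lambda _ fun k => ?_
    by_cases hk : k = j
    · subst hk; simpa using measurable_snd
    · simpa [Function.update_of_ne hk] using
        (by fun_prop : Measurable fun c : (ι → S) × S => c.1 k)
  refine ⟨hm, (Measure.pi_eq fun s hs => ?_).symm⟩
  rw [Measure.map_apply hm (MeasurableSet.univ_pi hs)]
  have : (fun p : (ι → S) × S => Function.update p.1 j p.2) ⁻¹' Set.univ.pi s =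
      Set.univ.pi (Function.update s j Set.univ) ×ˢ s j := by
    ext p
    simp only [Set.mem_preimage, Set.mem_pi, Set.mem_univ, true_imp_iff, Set.mem_prod]
    constructor
    · intro h
      refine ⟨fun k => ?_, by simpa using h j⟩
      by_cases hk : k = j
      · subst hk; simp
      · simpa [Function.update_of_ne hk] using h k
    · rintro ⟨h1, h2⟩ k
      by_cases hk : k = j
      · subst hk; simpa using h2
      · simpa [Function.update_of_ne hk] using h1 k
  rw [this, Measure.prod_prod, Measure.pi_pi, ← Finset.mul_prod_erase _ _ (Finset.mem_univ j),
    ← Finset.mul_prod_erase _ (fun i => γ (s i)) (Finset.mem_univ j), Function.update_self,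
    measure_univ, one_mul, mul_comm]
  congr 1
  exact Finset.prod_congr rfl fun k hk => by rw [Function.update_of_ne (Finset.ne_of_mem_erase hk)]

theorem lintegral_pi_eq_lintegral_update {ι S : Type*} [Fintype ι] [DecidableEq ι]
    [MeasurableSpace S] (γ : Measure S) [IsProbabilityMeasure γ] (j : ι) {F : (ι → S) → ℝ≥0∞}
    (hF : Measurable F) :
    ∫⁻ x, F x ∂(Measure.pi fun _ => γ) =
      ∫⁻ x, ∫⁻ y, F (Function.update x j y) ∂γ ∂(Measure.pi fun _ => γ) := by
  have h := measurePreserving_update_pi γ j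
  rw [← h.lintegral_comp hF]
  exact lintegral_prod _ (hF.comp h.measurable).aemeasurable

theorem lintegral_stdGaussian {d : ℕ} {F : EuclideanSpace ℝ (Fin d) → ℝ≥0∞} (hF : Measurable F) :
    ∫⁻ x, F x ∂(stdGaussian (EuclideanSpace ℝ (Fin d))) =
      ∫⁻ x, F (WithLp.toLp 2 x) ∂(Measure.pi fun _ : Fin d => gaussianReal 0 1) := by
  rw [← map_pi_eq_stdGaussian, lintegral_map hF (by fun_prop)]

namespace CoordPair

variable {d : ℕ}

/-- One element of a pair of coordinates. -/
noncomputable def fst (I : CoordPair d) : Fin d := (Finset.card_eq_two.1 I.2).choose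

/-- The other element of a pair of coordinates. -/
noncomputable def snd (I : CoordPair d) : Fin d := (Finset.card_eq_two.1 I.2).choose_spec.choose

theorem fst_ne_snd (I : CoordPair d) : I.fst ≠ I.snd :=
  (Finset.card_eq_two.1 I.2).choose_spec.choose_spec.1

theorem eq_pair (I : CoordPair d) : I.1 = {I.fst, I.snd} :=
  (Finset.card_eq_two.1 I.2).choose_spec.choose_spec.2

/-- The density of `pairGaussian σ I` relative to the standard Gaussian. -/
noncomputable def density (σ : ℝ) (I : CoordPair d) (x : EuclideanSpace ℝ (Fin d)) : ℝ :=
  corrDensity σ (x I.fst) (x I.snd)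

theorem measurable_density (σ : ℝ) (I : CoordPair d) : Measurable (density σ I) :=
  (measurable_corrDensity σ).comp
    (by fun_prop : Measurable fun x : EuclideanSpace ℝ (Fin d) => (x I.fst, x I.snd))

theorem pairCov_mulVec (σ : ℝ) (I : CoordPair d) (x : Fin d → ℝ) (a : Fin d) :
    (pairCov σ I).mulVec x a =
      x a + ((if a = I.fst then σ * x I.snd else 0) + if a = I.snd then σ * x I.fst else 0) := by
  have hne := I.fst_ne_snd
  have hent : ∀ b, pairCov σ I a b * x b = (if b = a then x a else 0) +
      ((if b = I.snd then (if a = I.fst then σ * x I.snd else 0) else 0) +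
        if b = I.fst then (if a = I.snd then σ * x I.fst else 0) else 0) := by
    intro b
    simp only [pairCov, Matrix.of_apply, I.eq_pair]
    have hpair : ({I.fst, I.snd} : Finset (Fin d)) = {a, b} ↔
        (a = I.fst ∧ b = I.snd) ∨ (a = I.snd ∧ b = I.fst) := by
      constructor
      · intro h
        have h1 : I.fst ∈ ({a, b} : Finset (Fin d)) := h ▸ by simp
        have h2 : I.snd ∈ ({a, b} : Finset (Fin d)) := h ▸ by simp
        simp only [Finset.mem_insert, Finset.mem_singleton] at h1 h2
        grind
      · rintro (⟨rfl, rfl⟩ | ⟨rfl, rfl⟩)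
        · rfl
        · exact Finset.pair_comm _ _
    rw [if_congr hpair rfl rfl]
    grind
  rw [Matrix.mulVec, dotProduct, Finset.sum_congr rfl fun b _ => hent b]
  simp [Finset.sum_add_distrib]

theorem dotProduct_pairCov_mulVec (σ : ℝ) (I : CoordPair d) (x : Fin d → ℝ) :
    x ⬝ᵥ (pairCov σ I).mulVec x = ∑ a, x a ^ 2 + 2 * σ * x I.fst * x I.snd := by
  simp only [dotProduct, pairCov_mulVec, mul_add, Finset.sum_add_distrib]
  simp only [mul_ite, mul_zero, Finset.sum_ite_eq', Finset.mem_univ, if_true]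
  rw [Finset.sum_congr rfl fun a _ => (sq (x a)).symm]
  ring

theorem sum_eq_fst_add_snd (I : CoordPair d) (f : Fin d → ℝ) :
    ∑ a, f a = f I.fst + f I.snd + ∑ a ∈ (Finset.univ.erase I.fst).erase I.snd, f a := by
  rw [← Finset.add_sum_erase _ _ (Finset.mem_univ I.fst), ← Finset.add_sum_erase _ _
    (Finset.mem_erase.2 ⟨I.fst_ne_snd.symm, Finset.mem_univ I.snd⟩), add_assoc]

theorem posSemidef_pairCov {σ : ℝ} (h0 : 0 < σ) (h1 : σ < 1) (I : CoordPair d) :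
    (pairCov σ I).PosSemidef := by
  refine Matrix.PosSemidef.of_dotProduct_mulVec_nonneg ?_ fun x => ?_
  · ext a b
    simp only [Matrix.conjTranspose_apply, pairCov, Matrix.of_apply, star_trivial]
    rw [Finset.pair_comm b a, if_congr (eq_comm : b = a ↔ a = b) rfl rfl]
  · rw [star_trivial, dotProduct_pairCov_mulVec, sum_eq_fst_add_snd I]
    have : 0 ≤ ∑ a ∈ (Finset.univ.erase I.fst).erase I.snd, x a ^ 2 :=
      Finset.sum_nonneg fun _ _ => sq_nonneg _
    nlinarith [sq_nonneg (x I.fst + x I.snd), sq_nonneg (x I.fst - x I.snd)]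

/-- The transpose of the linear map that correlates the second coordinate of the pair with the
first. -/
noncomputable def tilt (σ : ℝ) (I : CoordPair d) (ξ : EuclideanSpace ℝ (Fin d)) :
    EuclideanSpace ℝ (Fin d) :=
  WithLp.toLp 2 fun k => if k = I.fst then ξ I.fst + σ * ξ I.snd
    else if k = I.snd then √(1 - σ ^ 2) * ξ I.snd else ξ k

/-- The linear map that correlates the second coordinate of the pair with the first. -/
noncomputable def correlate (σ : ℝ) (I : CoordPair d) (x : Fin d → ℝ) : EuclideanSpace ℝ (Fin d) :=
  WithLp.toLp 2 (Function.update x I.snd (σ * x I.fst + √(1 - σ ^ 2) * x I.snd))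

theorem measurable_correlate (σ : ℝ) (I : CoordPair d) : Measurable (correlate σ I) := by
  refine (WithLp.measurable_toLp 2 _).comp (measurable_pi_lambda _ fun k => ?_)
  by_cases hk : k = I.snd
  · subst hk; simp only [Function.update_self]; fun_prop
  · simp only [Function.update_of_ne hk]; fun_prop

theorem sum_erase_congr (I : CoordPair d) {f g : Fin d → ℝ}
    (h : ∀ k, k ≠ I.fst → k ≠ I.snd → f k = g k) :
    ∑ k ∈ (Finset.univ.erase I.fst).erase I.snd, f k =
      ∑ k ∈ (Finset.univ.erase I.fst).erase I.snd, g k :=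
  Finset.sum_congr rfl fun k hk => by
    simp only [Finset.mem_erase, Finset.mem_univ, and_true] at hk
    exact h k hk.2 hk.1

theorem inner_correlate (σ : ℝ) (I : CoordPair d) (x : Fin d → ℝ) (ξ : EuclideanSpace ℝ (Fin d)) :
    inner ℝ (correlate σ I x) ξ = inner ℝ (WithLp.toLp 2 x) (tilt σ I ξ) := by
  have hne := I.fst_ne_snd
  simp only [PiLp.inner_apply, RCLike.inner_apply, conj_trivial]
  rw [sum_eq_fst_add_snd I, sum_eq_fst_add_snd I (fun k => tilt σ I ξ k * _)]
  rw [sum_erase_congr I (g := fun k =>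
    tilt σ I ξ k * (WithLp.toLp 2 x : EuclideanSpace ℝ (Fin d)) k)]
  · simp [correlate, tilt, hne, hne.symm]
    ring
  · intro k h1 h2
    simp [correlate, tilt, h1, h2]

theorem norm_tilt_sq {σ : ℝ} (h0 : 0 < σ) (h1 : σ < 1) (I : CoordPair d)
    (ξ : EuclideanSpace ℝ (Fin d)) :
    ‖tilt σ I ξ‖ ^ 2 = ∑ a, ξ a ^ 2 + 2 * σ * ξ I.fst * ξ I.snd := by
  have hne := I.fst_ne_snd
  rw [EuclideanSpace.real_norm_sq_eq, sum_eq_fst_add_snd I, sum_eq_fst_add_snd I (fun k => ξ k ^ 2),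
    sum_erase_congr I (g := fun k => ξ k ^ 2)]
  · simp only [tilt, if_true, hne.symm, if_false]
    rw [mul_pow, Real.sq_sqrt (one_sub_sq_pos h0 h1).le]
    ring
  · intro k h1 h2
    simp [tilt, h1, h2]

/-- Characteristic functions agree: `tilt` is the adjoint of `correlate`, and its squared norm is
the quadratic form of the covariance matrix. -/
theorem map_correlate_eq_pairGaussian {σ : ℝ} (h0 : 0 < σ) (h1 : σ < 1) (I : CoordPair d) :
    (Measure.pi fun _ : Fin d => gaussianReal 0 1).map (correlate σ I) = pairGaussian σ I := by
  have := Measure.isProbabilityMeasure_map (μ := Measure.pi fun _ : Fin d => gaussianReal 0 1)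
    (measurable_correlate σ I).aemeasurable
  unfold pairGaussian
  apply Measure.ext_of_charFun
  ext ξ
  rw [charFun_multivariateGaussian (posSemidef_pairCov h0 h1 I), charFun_apply,
    integral_map (measurable_correlate σ I).aemeasurable
      (Measurable.aestronglyMeasurable (by fun_prop))]
  simp_rw [inner_correlate]
  have h := charFun_stdGaussian (tilt σ I ξ)
  rw [charFun_apply, ← map_pi_eq_stdGaussian, integral_map (by fun_prop)
    (Measurable.aestronglyMeasurable (by fun_prop))] at h
  rw [h]
  congr 1
  have e : (ξ : EuclideanSpace ℝ (Fin d)).ofLp ⬝ᵥ (pairCov σ I).mulVec ξ.ofLp =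
      ‖tilt σ I ξ‖ ^ 2 := by
    rw [norm_tilt_sq h0 h1]; exact dotProduct_pairCov_mulVec σ I _
  rw [e]
  simp
  ring

/-- The law is obtained from the standard one by resampling the second coordinate of the pair from
its conditional law given the first, which has density `corrDensity`. -/
theorem pairGaussian_eq_withDensity {σ : ℝ} (h0 : 0 < σ) (h1 : σ < 1) (I : CoordPair d) :
    pairGaussian σ I = (stdGaussian (EuclideanSpace ℝ (Fin d))).withDensity
      fun x => ENNReal.ofReal (density σ I x) := by
  have hne := I.fst_ne_snd
  rw [← map_correlate_eq_pairGaussian h0 h1]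
  ext A hA
  have hind : Measurable (A.indicator fun _ : EuclideanSpace ℝ (Fin d) => (1 : ℝ≥0∞)) :=
    measurable_const.indicator hA
  have hdens := (measurable_density σ I).ennreal_ofReal
  have hupd : ∀ x : Fin d → ℝ, Measurable fun y : ℝ =>
      (WithLp.toLp 2 (Function.update x I.snd y) : EuclideanSpace ℝ (Fin d)) := fun x =>
    (WithLp.measurable_toLp 2 _).comp (measurable_update x)
  have hcomp : ∀ x : Fin d → ℝ, Measurable fun y : ℝ => A.indicator (fun _ => (1 : ℝ≥0∞))
      (WithLp.toLp 2 (Function.update x I.snd y) : EuclideanSpace ℝ (Fin d)) := fun x =>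
    hind.comp (hupd x)
  have hv := one_sub_sq_pos h0 h1
  -- the left hand side, with the second coordinate resampled
  have hl : (Measure.map (correlate σ I) (Measure.pi fun _ : Fin d => gaussianReal 0 1)) A =
      ∫⁻ x, ∫⁻ z, A.indicator (fun _ => (1 : ℝ≥0∞))
        (WithLp.toLp 2 (Function.update x I.snd z)) ∂(gaussianReal (σ * x I.fst)
          (1 - σ ^ 2).toNNReal) ∂(Measure.pi fun _ : Fin d => gaussianReal 0 1) := by
    rw [← lintegral_indicator_one hA]
    simp only [Pi.one_def]
    rw [lintegral_map hind (measurable_correlate σ I),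
      lintegral_pi_eq_lintegral_update _ I.snd
        (F := fun x => A.indicator (fun _ => 1) (correlate σ I x))
        (hind.comp (measurable_correlate σ I))]
    refine lintegral_congr fun x => ?_
    have hmap : (gaussianReal 0 1).map (fun y => σ * x I.fst + √(1 - σ ^ 2) * y) =
        gaussianReal (σ * x I.fst) (1 - σ ^ 2).toNNReal := by
      have : (fun y => σ * x I.fst + √(1 - σ ^ 2) * y) =
          (fun y => σ * x I.fst + y) ∘ fun y => √(1 - σ ^ 2) * y := rfl
      rw [this, ← Measure.map_map (by fun_prop) (by fun_prop), gaussianReal_map_const_mul,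
        gaussianReal_map_const_add]
      congr 1
      · simp
      · ext
        simp [Real.sq_sqrt hv.le, hv.le]
    rw [← hmap, lintegral_map (hcomp x) (by fun_prop)]
    refine lintegral_congr fun y => ?_
    simp [correlate, hne]
  rw [hl, withDensity_apply _ hA, ← lintegral_indicator hA,
    lintegral_stdGaussian (hdens.indicator hA),
    lintegral_pi_eq_lintegral_update _ I.snd
      (F := fun x => A.indicator (fun x => ENNReal.ofReal (density σ I x)) (WithLp.toLp 2 x))
      ((hdens.indicator hA).comp (WithLp.measurable_toLp 2 _))]
  refine lintegral_congr fun x => ?_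
  have hm : Measurable fun y => ENNReal.ofReal (corrDensity σ (x I.fst) y) :=
    ((measurable_corrDensity σ).comp
      (by fun_prop : Measurable fun y : ℝ => (x I.fst, y))).ennreal_ofReal
  rw [gaussianReal_eq_withDensity_corrDensity h0 h1,
    lintegral_withDensity_eq_lintegral_mul _ hm (hcomp x)]
  refine lintegral_congr fun y => ?_
  by_cases hy : (WithLp.toLp 2 (Function.update x I.snd y) : EuclideanSpace ℝ (Fin d)) ∈ A
  · simp [hy, density, hne]
  · simp [hy]

end CoordPair

/-! ### Orthogonality of the densities -/

namespace CoordPair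

variable {d : ℕ}

theorem density_pos {σ : ℝ} (h0 : 0 < σ) (h1 : σ < 1) (I : CoordPair d)
    (x : EuclideanSpace ℝ (Fin d)) : 0 < density σ I x :=
  corrDensity_pos h0 h1 _ _

theorem lintegral_fst_snd (I : CoordPair d) {F : ℝ × ℝ → ℝ≥0∞} (hF : Measurable F) :
    ∫⁻ x, F (x I.fst, x I.snd) ∂(stdGaussian (EuclideanSpace ℝ (Fin d))) =
      ∫⁻ x, ∫⁻ y, F (x, y) ∂(gaussianReal 0 1) ∂(gaussianReal 0 1) := by
  have hm : Measurable fun x : Fin d → ℝ => F (x I.fst, x I.snd) := hF.comp (by fun_prop)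
  have hm' : Measurable fun x : EuclideanSpace ℝ (Fin d) => F (x I.fst, x I.snd) :=
    hF.comp (by fun_prop)
  rw [lintegral_stdGaussian hm', lintegral_pi_eq_lintegral_update _ I.snd
    (F := fun x : Fin d → ℝ => F (x I.fst, x I.snd)) hm]
  simp only [Function.update_self, Function.update_of_ne I.fst_ne_snd]
  exact (measurePreserving_eval (fun _ : Fin d => gaussianReal 0 1) I.fst).lintegral_comp
    (f := fun x => ∫⁻ y, F (x, y) ∂(gaussianReal 0 1)) hF.lintegral_prod_right'

theorem lintegral_density_rpow_le {σ : ℝ} (h0 : 0 < σ) (h1 : σ ≤ 1 / 4) (I : CoordPair d) {l : ℝ}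
    (hl : |l - 1| * σ ≤ 1 / 2) :
    ∫⁻ x, ENNReal.ofReal (density σ I x ^ l) ∂(stdGaussian (EuclideanSpace ℝ (Fin d))) ≤
      ENNReal.ofReal (Real.exp (2 * ((|l| + 1) * σ) ^ 2)) := by
  refine le_trans (le_of_eq ?_) (lintegral_lintegral_corrDensity_rpow_le h0 h1 hl)
  exact lintegral_fst_snd I (F := fun p => ENNReal.ofReal (corrDensity σ p.1 p.2 ^ l))
    ((measurable_corrDensity σ).pow_const l).ennreal_ofReal

/-- Integrating out either coordinate of the pair. -/
theorem lintegral_density_update {σ : ℝ} (h0 : 0 < σ) (h1 : σ < 1) (I : CoordPair d)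
    {k : Fin d} (hk : k ∈ I.1) (x : Fin d → ℝ) :
    ∫⁻ y, ENNReal.ofReal (density σ I (WithLp.toLp 2 (Function.update x k y)))
      ∂(gaussianReal 0 1) = 1 := by
  have hne := I.fst_ne_snd
  rw [I.eq_pair, Finset.mem_insert, Finset.mem_singleton] at hk
  rcases hk with rfl | rfl
  · simp only [density, Function.update_self, Function.update_of_ne hne.symm]
    simp_rw [corrDensity_comm σ _ (x I.snd)]
    exact lintegral_corrDensity_eq_one h0 h1 _
  · simp only [density, Function.update_self, Function.update_of_ne hne]
    exact lintegral_corrDensity_eq_one h0 h1 _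

/-- Given all coordinates except `k`, the density has mean `1`, and `F` is constant. -/
theorem lintegral_density_mul {σ : ℝ} (h0 : 0 < σ) (h1 : σ < 1) (I : CoordPair d)
    {k : Fin d} (hk : k ∈ I.1) {F : EuclideanSpace ℝ (Fin d) → ℝ≥0∞} (hF : Measurable F)
    (hFk : ∀ (x : Fin d → ℝ) (y : ℝ),
      F (WithLp.toLp 2 (Function.update x k y)) = F (WithLp.toLp 2 x)) :
    ∫⁻ x, ENNReal.ofReal (density σ I x) * F x ∂(stdGaussian (EuclideanSpace ℝ (Fin d))) =
      ∫⁻ x, F x ∂(stdGaussian (EuclideanSpace ℝ (Fin d))) := by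
  have hd := (measurable_density σ I).ennreal_ofReal
  have hm : Measurable fun x : Fin d → ℝ =>
      ENNReal.ofReal (density σ I (WithLp.toLp 2 x)) * F (WithLp.toLp 2 x) :=
    (hd.mul hF).comp (WithLp.measurable_toLp 2 _)
  have hm' : Measurable fun x : EuclideanSpace ℝ (Fin d) => ENNReal.ofReal (density σ I x) * F x :=
    hd.mul hF
  rw [lintegral_stdGaussian hm', lintegral_stdGaussian hF,
    lintegral_pi_eq_lintegral_update _ k (F := fun x : Fin d → ℝ =>
      ENNReal.ofReal (density σ I (WithLp.toLp 2 x)) * F (WithLp.toLp 2 x)) hm]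
  refine lintegral_congr fun x => ?_
  simp_rw [hFk]
  rw [lintegral_mul_const, lintegral_density_update h0 h1 I hk, one_mul]
  exact hd.comp ((WithLp.measurable_toLp 2 _).comp (measurable_update x))

theorem lintegral_density {σ : ℝ} (h0 : 0 < σ) (h1 : σ < 1) (I : CoordPair d) :
    ∫⁻ x, ENNReal.ofReal (density σ I x) ∂(stdGaussian (EuclideanSpace ℝ (Fin d))) = 1 := by
  have := lintegral_density_mul h0 h1 I (k := I.fst) (by rw [I.eq_pair]; simp)
    (F := fun _ => 1) measurable_const (fun _ _ => rfl)
  simpa using this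

theorem integral_density {σ : ℝ} (h0 : 0 < σ) (h1 : σ < 1) (I : CoordPair d) :
    ∫ x, density σ I x ∂(stdGaussian (EuclideanSpace ℝ (Fin d))) = 1 := by
  rw [integral_eq_lintegral_of_nonneg_ae
    (Filter.Eventually.of_forall fun x => (density_pos h0 h1 I x).le)
    (measurable_density σ I).aestronglyMeasurable, lintegral_density h0 h1, ENNReal.toReal_one]

theorem integral_density_mul_density {σ : ℝ} (h0 : 0 < σ) (h1 : σ < 1) {I J : CoordPair d}
    (hIJ : I ≠ J) :
    ∫ x, density σ I x * density σ J x ∂(stdGaussian (EuclideanSpace ℝ (Fin d))) = 1 := by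
  obtain ⟨k, hkI, hkJ⟩ : ∃ k ∈ I.1, k ∉ J.1 := by
    by_contra! h
    exact hIJ (Subtype.ext (Finset.eq_of_subset_of_card_le h (by rw [I.2, J.2])))
  rw [J.eq_pair, Finset.mem_insert, Finset.mem_singleton, not_or] at hkJ
  rw [integral_eq_lintegral_of_nonneg_ae
    (Filter.Eventually.of_forall fun x =>
      (mul_pos (density_pos h0 h1 I x) (density_pos h0 h1 J x)).le)
    ((measurable_density σ I).mul (measurable_density σ J)).aestronglyMeasurable]
  simp_rw [ENNReal.ofReal_mul (density_pos h0 h1 I _).le]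
  rw [lintegral_density_mul h0 h1 I hkI (measurable_density σ J).ennreal_ofReal,
    lintegral_density h0 h1, ENNReal.toReal_one]
  intro x y
  simp [density, Function.update_of_ne (Ne.symm hkJ.1), Function.update_of_ne (Ne.symm hkJ.2)]

/-- The moment bound at `l = 2` is `exp (18 * σ ^ 2)`, and `exp x - 1 ≤ 2 * x` for `0 ≤ x ≤ 1`. -/
theorem integrable_density_sq {σ : ℝ} (h0 : 0 < σ) (h1 : σ ≤ 1 / 8) (I : CoordPair d) :
    Integrable (fun x => density σ I x ^ 2) (stdGaussian (EuclideanSpace ℝ (Fin d))) ∧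
      ∫ x, density σ I x ^ 2 ∂(stdGaussian (EuclideanSpace ℝ (Fin d))) ≤ 1 + 36 * σ ^ 2 := by
  have h := lintegral_density_rpow_le h0 (by linarith) I (l := 2) (by norm_num; linarith)
  simp only [Real.rpow_two] at h
  have hm : AEStronglyMeasurable (fun x => density σ I x ^ 2)
      (stdGaussian (EuclideanSpace ℝ (Fin d))) :=
    ((measurable_density σ I).pow_const 2).aestronglyMeasurable
  have hnn : 0 ≤ᵐ[stdGaussian (EuclideanSpace ℝ (Fin d))] fun x => density σ I x ^ 2 :=
    Filter.Eventually.of_forall fun x => sq_nonneg _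
  refine ⟨⟨hm, (hasFiniteIntegral_iff_ofReal hnn).2 (h.trans_lt ENNReal.ofReal_lt_top)⟩, ?_⟩
  rw [integral_eq_lintegral_of_nonneg_ae hnn hm]
  refine (ENNReal.toReal_le_of_le_ofReal (Real.exp_pos _).le h).trans ?_
  have e : 2 * ((|(2 : ℝ)| + 1) * σ) ^ 2 = 18 * σ ^ 2 := by norm_num; ring
  have h18 : 18 * σ ^ 2 ≤ 1 := by nlinarith
  rw [e]
  have := Real.abs_exp_sub_one_le (x := 18 * σ ^ 2)
    (by rw [abs_of_nonneg (by positivity)]; exact h18)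
  rw [abs_of_nonneg (by positivity : 0 ≤ 18 * σ ^ 2)] at this
  linarith [le_abs_self (Real.exp (18 * σ ^ 2) - 1)]

/-- Distinct pairs give uncorrelated densities, so the square expands into its diagonal, where the
variance is at most `(6 * σ) ^ 2`. -/
theorem isBesselFamily_density {σ : ℝ} (h0 : 0 < σ) (h1 : σ ≤ 1 / 8) :
    IsBesselFamily (stdGaussian (EuclideanSpace ℝ (Fin d))) (density (d := d) σ) (6 * σ) := by
  have hσ1 : σ < 1 := by linarith
  have hL2 : ∀ I : CoordPair d, MemLp (density σ I) 2 (stdGaussian (EuclideanSpace ℝ (Fin d))) :=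
    fun I => (memLp_two_iff_integrable_sq (measurable_density σ I).aestronglyMeasurable).2
      (integrable_density_sq h0 h1 I).1
  refine ⟨measurable_density σ, fun I x => (density_pos h0 hσ1 I x).le, hL2,
    integral_density h0 hσ1, fun a => ?_⟩
  have hc : ∀ I : CoordPair d, MemLp (fun x => density σ I x - 1) 2
      (stdGaussian (EuclideanSpace ℝ (Fin d))) := fun I => (hL2 I).sub (memLp_const 1)
  have hint : ∀ I J : CoordPair d, Integrable (fun x => (density σ I x - 1) * (density σ J x - 1))
      (stdGaussian (EuclideanSpace ℝ (Fin d))) := fun I J => (hc I).integrable_mul (hc J)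
  have hcov : ∀ I J : CoordPair d, ∫ x, (density σ I x - 1) * (density σ J x - 1)
      ∂(stdGaussian (EuclideanSpace ℝ (Fin d))) =
      ∫ x, density σ I x * density σ J x ∂(stdGaussian (EuclideanSpace ℝ (Fin d))) - 1 := by
    intro I J
    have hI := (hL2 I).integrable one_le_two
    have hJ := (hL2 J).integrable one_le_two
    have hIJ : Integrable (fun x => density σ I x * density σ J x)
      (stdGaussian (EuclideanSpace ℝ (Fin d))) := (hL2 I).integrable_mul (hL2 J)
    have e : ∀ x, (density σ I x - 1) * (density σ J x - 1) =
        density σ I x * density σ J x - (density σ I x + density σ J x - 1) := fun x => by ring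
    have hs : Integrable (fun x => density σ I x + density σ J x - 1)
      (stdGaussian (EuclideanSpace ℝ (Fin d))) := (hI.add hJ).sub (integrable_const _)
    have hs' : Integrable (fun x => density σ I x + density σ J x)
      (stdGaussian (EuclideanSpace ℝ (Fin d))) := hI.add hJ
    simp_rw [e]
    rw [integral_sub hIJ hs, integral_sub hs' (integrable_const _), integral_add hI hJ,
      integral_density h0 hσ1, integral_density h0 hσ1]
    simp
  have hexp : ∀ x, (∑ I, a I * (density σ I x - 1)) ^ 2 =
      ∑ I, ∑ J, a I * a J * ((density σ I x - 1) * (density σ J x - 1)) := by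
    intro x
    rw [sq, Finset.sum_mul_sum]
    exact Finset.sum_congr rfl fun I _ => Finset.sum_congr rfl fun J _ => by ring
  simp_rw [hexp]
  rw [integral_finsetSum _ fun I _ => integrable_finsetSum _ fun J _ => (hint I J).const_mul _]
  rw [Finset.mul_sum]
  refine Finset.sum_le_sum fun I _ => ?_
  rw [integral_finsetSum _ fun J _ => (hint I J).const_mul _, Finset.sum_eq_single I]
  · rw [integral_const_mul, hcov]
    have := (integrable_density_sq h0 h1 I).2
    simp_rw [← sq]
    have h2 := mul_le_mul_of_nonneg_left this (sq_nonneg (a I))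
    nlinarith
  · intro J _ hJ
    rw [integral_const_mul, hcov, integral_density_mul_density h0 hσ1 hJ.symm, sub_self, mul_zero]
  · simp

end CoordPair

/-! ### Fixing the coins, and the choice of constants -/

/-- Fixing the coins of a protocol that is correct with high probability under every law of a
family, without loss on average over the family. -/
theorem RandProtocol.exists_coins {m : ℕ} {X ι : Type*} [MeasurableSpace X] [Fintype ι]
    (π : RandProtocol.{u} m X ι) (μ : ι → Measure (Fin m → X)) [∀ i, IsProbabilityMeasure (μ i)]
    (μ₀ : Measure (Fin m → X)) [IsProbabilityMeasure μ₀] {ε : ℝ}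
    (h : ∀ i, 1 - ε ≤ (π.law.prod (μ i)).real {p | (π.det p.1).output p.2 = i}) :
    ∃ c, (1 - ε) * Fintype.card ι - 1 ≤ ∑ i,
      ((μ i).real {x | (π.det c).output x = i} - μ₀.real {x | (π.det c).output x = i}) := by
  have hint : ∀ i, Integrable (fun c => (μ i).real {x | (π.det c).output x = i}) π.law := fun i =>
    Measure.integrable_measure_prodMk_left (ν := μ i) (π.measurableSet_output i)
      (measure_ne_top _ _)
  have heq : ∀ i, (π.law.prod (μ i)).real {p | (π.det p.1).output p.2 = i} =
      ∫ c, (μ i).real {x | (π.det c).output x = i} ∂π.law := by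
    intro i
    rw [Measure.real, Measure.prod_apply (π.measurableSet_output i), ← integral_toReal
      (measurable_measure_prodMk_left (π.measurableSet_output i)).aemeasurable
      (Filter.Eventually.of_forall fun c => measure_lt_top _ _)]
    rfl
  obtain ⟨c, hc⟩ := exists_integral_le (integrable_finsetSum Finset.univ fun i _ => hint i)
  refine ⟨c, ?_⟩
  rw [integral_finsetSum _ fun i _ => hint i] at hc
  have h1 : (1 - ε) * Fintype.card ι ≤
      ∑ i, ∫ c, (μ i).real {x | (π.det c).output x = i} ∂π.law := by
    calc (1 - ε) * Fintype.card ι = ∑ _i : ι, (1 - ε) := by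
          rw [Finset.sum_const, Finset.card_univ, nsmul_eq_mul, mul_comm]
      _ ≤ _ := Finset.sum_le_sum fun i _ => (h i).trans (heq i).le
  -- Under one common law the events of different outputs are disjoint.
  have h2 : ∑ i, μ₀.real {x | (π.det c).output x = i} ≤ 1 := by
    rw [← measureReal_biUnion_finset]
    · exact measureReal_le_one
    · intro i _ j _ hij
      refine Set.disjoint_left.2 fun x hx hx' => hij ?_
      exact (show (π.det c).output x = i from hx).symm.trans hx'
    · exact fun i _ => measurable_prodMk_left (π.measurableSet_output i)
  rw [Finset.sum_sub_distrib]
  linarith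

theorem CoordPair.card_eq (d : ℕ) : (Fintype.card (CoordPair d) : ℝ) = d * (d - 1) / 2 := by
  rw [Fintype.card_finset_len, Fintype.card_fin, Nat.cast_choose_two]

/-- The lower bound on the length of a deterministic protocol, in terms of `l = log Z`. -/
theorem DetProtocol.le_mul_of_separates_pairGaussian {d n m : ℕ} {σ Z l : ℝ} (hd : 3 ≤ d)
    (hn : 1 ≤ n) (h0 : 0 < σ) (hdn : (d : ℝ) ^ 4 ≤ n)
    (hl : l = Real.log Z) (hl1 : 1 ≤ l) (hdZ : (d : ℝ) ≤ Z) (hnZ : (n : ℝ) ≤ Z) (hmZ : (m : ℝ) ≤ Z)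
    (hZ : 50 ≤ Z) (hσ : σ * √n * l ≤ 1 / 10 ^ 4)
    (π : DetProtocol m (Fin n → EuclideanSpace ℝ (Fin d)) (CoordPair d)) (B : ℕ)
    (hB : ∀ x, π.bitsSent x ≤ B)
    (hsep : (Fintype.card (CoordPair d) : ℝ) / 2 ≤ ∑ I : CoordPair d,
      ((Measure.pi fun _ : Fin m => Measure.pi fun _ : Fin n => pairGaussian σ I).real
          {x | π.output x = I} -
        (Measure.pi fun _ : Fin m => Measure.pi fun _ : Fin n =>
          stdGaussian (EuclideanSpace ℝ (Fin d))).real {x | π.output x = I})) :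
    (d : ℝ) ^ 2 ≤ 10 ^ 8 * (σ ^ 2 * n * l ^ 2) * B := by
  have hd' : (3 : ℝ) ≤ d := by exact_mod_cast hd
  have hn' : (1 : ℝ) ≤ n := by exact_mod_cast hn
  have hm' : (0 : ℝ) ≤ m := Nat.cast_nonneg m
  have hcard := CoordPair.card_eq d
  set N : ℝ := (Fintype.card (CoordPair d) : ℝ) with hN
  have hN1 : (d : ℝ) ^ 2 ≤ 3 * N := by nlinarith
  have hN2 : N ≤ (d : ℝ) ^ 2 := by nlinarith
  have hN3 : 3 ≤ N := by nlinarith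
  have hNne : Nonempty (CoordPair d) := by
    rw [← Fintype.card_pos_iff]
    have : (0 : ℝ) < N := by linarith
    rw [hN] at this
    exact_mod_cast this
  have hsn1 : 1 ≤ √(n : ℝ) := Real.one_le_sqrt.2 hn'
  have hsn := Real.sq_sqrt (by linarith : (0 : ℝ) ≤ n)
  have hσn : σ * √n ≤ 1 / 10 ^ 4 := le_trans (le_mul_of_one_le_right (by positivity) hl1) hσ
  have hσ1 : σ ≤ 1 / 10 ^ 4 := le_trans (le_mul_of_one_le_right h0.le hsn1) hσn
  have hq : σ ^ 2 * n * l ^ 2 = (σ * √n * l) ^ 2 := by rw [mul_pow, mul_pow, hsn]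
  have hq1 : (σ * √n * l) ^ 2 ≤ (1 / 10 ^ 4) ^ 2 := pow_le_pow_left₀ (by positivity) hσ 2
  have hq2 : (σ * √n) ^ 2 ≤ (1 / 10 ^ 4) ^ 2 := pow_le_pow_left₀ (by positivity) hσn 2
  rw [mul_pow, hsn] at hq2
  have hZ0 : 0 < Z := by linarith
  have hL := CoordPair.isBesselFamily_density (d := d) h0 (by linarith)
  -- The choice `τ = 80 * l`: against `8 * N * n ≤ Z ^ 4` it leaves `Z ^ (-6)`, with square root `Z
  -- ^ (-3)`, which still beats the factor `m ≤ Z`.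
  have hexp : Real.exp (-(80 * l / 8)) = (Z ^ 10)⁻¹ := by
    rw [hl, Real.exp_neg, ← Real.exp_log (pow_pos hZ0 10), Real.log_pow]
    congr 2; push_cast; ring
  have hδ : 2 * √(8 * N * n * Real.exp (-(80 * l / 8))) ≤ 2 * (Z ^ 3)⁻¹ := by
    refine mul_le_mul_of_nonneg_left ?_ zero_le_two
    rw [hexp]
    refine Real.sqrt_le_iff.2 ⟨by positivity, ?_⟩
    have e : ((Z ^ 3)⁻¹) ^ 2 = Z ^ 4 * (Z ^ 10)⁻¹ := by field_simp
    rw [e]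
    refine mul_le_mul_of_nonneg_right ?_ (by positivity)
    have h1 : N ≤ Z ^ 2 := hN2.trans (pow_le_pow_left₀ (by linarith) hdZ 2)
    calc 8 * N * n ≤ Z * Z ^ 2 * Z :=
          mul_le_mul (mul_le_mul (by linarith) h1 (by linarith) hZ0.le) hnZ (by linarith)
            (by positivity)
      _ = Z ^ 4 := by ring
  have hZ2 : 2500 ≤ Z ^ 2 := by nlinarith
  have hmδ : m * (2 * (Z ^ 3)⁻¹) ≤ 1 / 1000 := by
    calc m * (2 * (Z ^ 3)⁻¹) ≤ Z * (2 * (Z ^ 3)⁻¹) :=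
          mul_le_mul_of_nonneg_right hmZ (by positivity)
      _ = 2 * (Z ^ 2)⁻¹ := by field_simp
      _ ≤ 2 * (2500)⁻¹ := by gcongr
      _ ≤ 1 / 1000 := by norm_num
  have hδ1 : 2 * (Z ^ 3)⁻¹ ≤ 1 := by
    have h3 : 2 ≤ Z ^ 3 := by nlinarith
    rw [← div_eq_mul_inv, div_le_one (by positivity)]; exact h3
  have hmain := hL.card_le_of_separates (by positivity) (fun I x =>
      CoordPair.density_pos h0 (by linarith) I x) h0
    (fun I p hp => CoordPair.lintegral_density_rpow_le h0 (by linarith) I hp) hn (by linarith)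
    (by nlinarith) (τ := 80 * l) (by positivity) (by linarith) hδ1 hδ π B hB
    (by simpa only [CoordPair.pairGaussian_eq_withDensity h0 (by linarith : σ < 1)] using hsep)
  -- The constant: `128 * 36 + 32 * 6400 + 6400 = 215808`. The middle term, from the uniform bound,
  -- is where `d ^ 4 ≤ n` enters.
  have hK : 128 * (6 * σ) ^ 2 * n + 32 * N ^ 2 * (σ * (80 * l)) ^ 2 + (σ * √n * (80 * l)) ^ 2 ≤
      216000 * (σ ^ 2 * n * l ^ 2) := by
    have h1 : N ^ 2 ≤ n := by
      calc N ^ 2 ≤ ((d : ℝ) ^ 2) ^ 2 := pow_le_pow_left₀ (by linarith) hN2 2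
        _ = (d : ℝ) ^ 4 := by ring
        _ ≤ n := hdn
    have h2 : N ^ 2 * (σ ^ 2 * l ^ 2) ≤ n * (σ ^ 2 * l ^ 2) :=
      mul_le_mul_of_nonneg_right h1 (by positivity)
    have h3 : σ ^ 2 * n ≤ σ ^ 2 * n * l ^ 2 :=
      le_mul_of_one_le_right (by positivity) (one_le_pow₀ hl1)
    have h4 : (σ * √n * (80 * l)) ^ 2 = 6400 * (σ ^ 2 * n * l ^ 2) := by rw [hq]; ring
    have h5 : 0 ≤ σ ^ 2 * n * l ^ 2 := by positivity
    rw [h4]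
    linarith
  have hB0 : (0 : ℝ) ≤ B := Nat.cast_nonneg B
  have hKB := mul_le_mul_of_nonneg_right hK (by linarith : (0 : ℝ) ≤ B + 1)
  have hNm := mul_le_mul_of_nonneg_left hmδ (by linarith : 0 ≤ N)
  -- As `q ≤ 10 ^ (-8)` and `3 ≤ N`, the `1` in `B + 1` is absorbed into the left side.
  rw [← hq] at hq1
  set q := σ ^ 2 * n * l ^ 2 with hqdef
  norm_num at hq1
  linarith

theorem theorem5 :
    ∃ C : ℝ, 0 < C ∧
      ∀ d n m : ℕ, 3 ≤ d → 1 ≤ n → 1 ≤ m →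
      ∀ σ : ℝ, 0 < σ → σ < 1 →
        C * (d : ℝ) ^ 6 ≤ (n : ℝ) →
        σ ≤ (n : ℝ) ^ (-(1 / 2) : ℝ) * (Real.log d) ^ (-(1 / 2) : ℝ) *
              (Real.log (d * n * m / σ))⁻¹ / C →
      ∀ π : RandProtocol.{u} m (Fin n → EuclideanSpace ℝ (Fin d)) (CoordPair d),
        π.Identifies (pairGaussian σ) (1 / 6) →
        ENNReal.ofReal
            ((d : ℝ) ^ 2 /
              (C * σ ^ 2 * Real.log (n * m * d / σ) ^ 2 * Real.log (d / (n * σ ^ 2)) * n))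
          ≤ (π.commComplexity : ℝ≥0∞) := by
  refine ⟨10 ^ 8, by norm_num, ?_⟩
  intro d n m hd hn hm σ h0 h1 hdn hσ π hπ
  have hd' : (3 : ℝ) ≤ d := by exact_mod_cast hd
  have hn' : (1 : ℝ) ≤ n := by exact_mod_cast hn
  have hm' : (1 : ℝ) ≤ m := by exact_mod_cast hm
  have hexp3 : Real.exp 1 ≤ 3 := by linarith [Real.exp_one_lt_d9]
  set Z : ℝ := n * m * d / σ with hZ
  have hZe : (d : ℝ) * n * m / σ = Z := by rw [hZ]; ring
  rw [hZe] at hσ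
  -- the parameters are in range
  have hnmd : (n : ℝ) * m * d ≤ Z := by
    rw [hZ, le_div_iff₀ h0]; exact mul_le_of_le_one_right (by positivity) h1.le
  have hdZ : (d : ℝ) ≤ Z := le_trans (le_mul_of_one_le_left (by linarith) (by nlinarith)) hnmd
  have hnZ : (n : ℝ) ≤ Z := by
    refine le_trans ?_ hnmd
    rw [mul_assoc]; exact le_mul_of_one_le_right (by linarith) (by nlinarith)
  have hmZ : (m : ℝ) ≤ Z := by
    refine le_trans ?_ hnmd
    rw [mul_comm (n : ℝ), mul_assoc]; exact le_mul_of_one_le_right (by linarith) (by nlinarith)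
  have hd6 : (d : ℝ) ^ 4 ≤ (d : ℝ) ^ 6 := pow_le_pow_right₀ (by linarith) (by norm_num)
  have hd4 : 81 ≤ (d : ℝ) ^ 4 := by
    calc (81 : ℝ) = 3 ^ 4 := by norm_num
      _ ≤ _ := pow_le_pow_left₀ (by norm_num) hd' 4
  have hdn4 : (d : ℝ) ^ 4 ≤ n := by nlinarith
  have hZ50 : 50 ≤ Z := by linarith
  have hlogd : 1 ≤ Real.log d := by
    rw [Real.le_log_iff_exp_le (by linarith)]; linarith
  have hl1 : 1 ≤ Real.log Z := by
    rw [Real.le_log_iff_exp_le (by linarith)]; linarith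
  set l := Real.log Z with hl
  have hsn0 : 0 < √(n : ℝ) := Real.sqrt_pos.2 (by linarith)
  have hsn := Real.sq_sqrt (by linarith : (0 : ℝ) ≤ n)
  have hσl : σ * √n * l ≤ 1 / 10 ^ 8 := by
    have e1 : (n : ℝ) ^ (-(1 / 2) : ℝ) = (√n)⁻¹ := by
      rw [Real.rpow_neg (by linarith), ← Real.sqrt_eq_rpow]
    have e2 : Real.log d ^ (-(1 / 2) : ℝ) ≤ 1 :=
      Real.rpow_le_one_of_one_le_of_nonpos hlogd (by norm_num)
    rw [e1] at hσ
    have h2 : σ ≤ (√(n : ℝ))⁻¹ * l⁻¹ / 10 ^ 8 := by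
      refine hσ.trans ?_
      gcongr
      exact mul_le_of_le_one_right (by positivity) e2
    calc σ * √n * l ≤ ((√(n : ℝ))⁻¹ * l⁻¹ / 10 ^ 8) * √n * l := by gcongr
      _ = 1 / 10 ^ 8 := by field_simp
  have hσn : n * σ ^ 2 ≤ 1 := by
    have h2 : σ * √n ≤ 1 := by
      refine le_trans (le_mul_of_one_le_right (by positivity) hl1) (hσl.trans (by norm_num))
    calc n * σ ^ 2 = (σ * √n) ^ 2 := by rw [mul_pow, hsn]; ring
      _ ≤ 1 := pow_le_one₀ (by positivity) h2
  -- Inserting this factor into the denominator only weakens the bound.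
  have hL' : 1 ≤ Real.log (d / (n * σ ^ 2)) := by
    have h3 : 3 ≤ d / (n * σ ^ 2) := by
      rw [le_div_iff₀ (by positivity)]; nlinarith
    rw [Real.le_log_iff_exp_le (by linarith)]; linarith
  -- the length of the protocol
  rcases eq_or_ne π.commComplexity ⊤ with htop | htop
  · simp [htop]
  obtain ⟨B, hB⟩ := ENat.ne_top_iff_exists.1 htop
  have : ∀ I : CoordPair d, IsProbabilityMeasure (pairGaussian σ I) := fun I => by
    unfold pairGaussian; infer_instance
  obtain ⟨c, hc⟩ := π.exists_coins
    (fun I => Measure.pi fun _ : Fin m => Measure.pi fun _ : Fin n => pairGaussian σ I)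
    (Measure.pi fun _ : Fin m => Measure.pi fun _ : Fin n =>
      stdGaussian (EuclideanSpace ℝ (Fin d))) hπ
  have hbits : ∀ x, (π.det c).bitsSent x ≤ B := by
    intro x
    have : ((π.det c).bitsSent x : ℕ∞) ≤ π.commComplexity :=
      le_iSup₂ (f := fun c x => ((π.det c).bitsSent x : ℕ∞)) c x
    rw [← hB] at this
    exact_mod_cast this
  -- From `3` on, `5 / 6 * N - 1` is at least `N / 2`, the separation that is required.
  have hN3 : (3 : ℝ) ≤ Fintype.card (CoordPair d) := by rw [CoordPair.card_eq]; nlinarith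
  have hmain := (π.det c).le_mul_of_separates_pairGaussian hd hn h0 hdn4 hl hl1 hdZ hnZ hmZ hZ50
    (hσl.trans (by norm_num)) B hbits (le_trans (by linarith) hc)
  rw [← hB, ENat.toENNReal_coe, ← ENNReal.ofReal_natCast]
  refine ENNReal.ofReal_le_ofReal ?_
  rw [div_le_iff₀ (by positivity)]
  have hq : 0 ≤ 10 ^ 8 * (σ ^ 2 * n * l ^ 2) * (B : ℝ) := by positivity
  calc (d : ℝ) ^ 2 ≤ 10 ^ 8 * (σ ^ 2 * n * l ^ 2) * B := hmain
    _ ≤ 10 ^ 8 * (σ ^ 2 * n * l ^ 2) * B * Real.log (d / (n * σ ^ 2)) :=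
        le_mul_of_one_le_right hq hL'
    _ = _ := by ring
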